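/- Let $M$ be a smooth manifold and let $E$ be a real exact Courant algebroid over $M$: a smooth extension $0\to T^*M\xrightarrow{\iota}E\xrightarrow{\pi}TM\to 0$ with a nondegenerate symmetric pairing $\langle\cdot,\cdot\rangle$ and a bracket on sections satisfying the exact Courant algebroid axioms, where the pairing $E\to E^*$ is an isomorphism of extensions, i.e. $\langle\iota\xi,e\rangle=\xi(\pi(e))$. (On $TM\oplus T^*M$ with pairing $\tfrac12(\xi(Y)+\eta(X))$ this means $\iota\xi=2\xi$.) Let $(\mathcal J_+,\mathcal J_-)$ be a generalized Kähler structure on $E$: two commuting generalized complex structures (orthogonal, square $-1$, with involutive $+i$-eigenbundles $L_\pm\subset E\otimes\mathbb C$) such that $\langle\mathcal J_+x,\mathcal J_-y\rangle$ is positive definite. Let $C_\pm$ be the $\pm1$-eigenbundles of $-\mathcal J_+\mathcal J_-$, let $s_\pm:TM\to C_\pm$ be the inverses of $\pi|_{C_\pm}$, let $g$ be the Riemannian metric $g(X,Y)=\langle s_+X,s_+Y\rangle=-\langle s_-X,s_-Y\rangle$, let $I_\pm=\pi\circ\mathcal J_+\circ s_\pm$ and $X_\pm=(M,I_\pm)$,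 and let $I_\pm^*$ be the transpose of $I_\pm$ acting on $T^*M$. Put $\ell_+=L_+\cap L_-$ and $\ell_-=L_+\cap\overline{L_-}$. Then $I_\pm$ are integrable complex structures. In the reductions $\mathcal E_\pm=\overline\ell_\pm^{\perp}/\overline\ell_\pm$, which are extensions of $T_{1,0}X_\pm$ by $T^*_{1,0}X_\pm$ with holomorphic structure $\bar\partial_X[e]=[[\tilde X,e]]$ (for $\tilde X\in\overline\ell_\pm$ lifting $X\in T_{0,1}X_\pm$), let $\mathcal A_\pm$ be the reduction $(L\cap\overline\ell_\pm^\perp+\overline\ell_\pm)/\overline\ell_\pm$ of the $-i$-eigenbundle $L$ of $\mathcal J_+$, and let $\mathcal B_+$, $\mathcal B_-$ be the reductions of the $-i$- and $+i$-eigenbundle of $\mathcal J_-$, respectively. These are transverse holomorphic Dirac structures, $\mathcal E_\pm=\mathcal A_\pm\oplus\mathcal B_\pm$. Let $\mathcal E_\pm^\top$ be $\mathcal E_\pm$ with the opposite pairing, so that the Baer sum is $\mathcal E_\pm^\top\boxtimes\mathcal E_\pm=(\mathcal E_\pm\oplus_{T_{1,0}}\mathcal E_\pm)/K$ with $K=\{(\iota\xi,\iota\xi):\xi\in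 T^*_{1,0}X_\pm\}$. Identify it with $T_{1,0}X_\pm\oplus T_{1,0}^*X_\pm$, where $X+\xi$ is the class of $(e,e+\iota\xi)$ for any $e\in\mathcal E_\pm$ lying over $X$. Then the Baer sum $$\mathcal A_\pm^\top\boxtimes\mathcal B_\pm=\frac{(\mathcal A_\pm\oplus_{T_{1,0}}\mathcal B_\pm)+K}{K}$$ is the graph $\{\sigma_\pm(\xi)+\xi:\xi\in T^*_{1,0}X_\pm\}$ of a holomorphic Poisson structure $\sigma_\pm$ on $X_\pm$ (a holomorphic bivector field with $[\sigma_\pm,\sigma_\pm]=0$). Both $\sigma_+$ and $\sigma_-$, viewed as maps $T^*M\otimes\mathbb C\to TM\otimes\mathbb C$, have real part $$\mathrm{Re}(\sigma_\pm)=\tfrac18\,g^{-1}[I_+^*,I_-^*].$$ -/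

import Mathlib

open scoped Manifold ContDiff
open Bundle VectorField

set_option linter.unusedSectionVars false

noncomputable section

namespace GenKahler

/-! ### Signs and complexification -/

/-- The two signs labelling the two halves of a generalized Kähler structure. -/
inductive Sgn where
  | plus
  | minus

/-- The real number `+1` or `-1`. -/
def Sgn.val : Sgn → ℝ
  | .plus => 1
  | .minus => -1

theorem Sgn.val_mul_val (s : Sgn) : s.val * s.val = 1 := by
  cases s <;> simp [Sgn.val]

/-- The complexification `V ⊗ ℂ` of a real vector space; `⟨a, b⟩` stands for `a + i b`. -/
@[ext] structure Cx (V : Type*) where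
  re : V
  im : V

namespace Cx

variable {V W : Type*}

/-- The underlying pair. -/
def equivProd (V : Type*) : Cx V ≃ V × V where
  toFun v := (v.re, v.im)
  invFun p := ⟨p.1, p.2⟩
  left_inv _ := rfl
  right_inv _ := rfl

variable [AddCommGroup V] [Module ℝ V] [AddCommGroup W] [Module ℝ W]

instance : AddCommGroup (Cx V) := (equivProd V).addCommGroup

instance : SMul ℂ (Cx V) :=
  ⟨fun z v => ⟨z.re • v.re - z.im • v.im, z.re • v.im + z.im • v.re⟩⟩

@[simp] theorem add_re (v w : Cx V) : (v + w).re = v.re + w.re := rfl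
@[simp] theorem add_im (v w : Cx V) : (v + w).im = v.im + w.im := rfl
@[simp] theorem zero_re : (0 : Cx V).re = 0 := rfl
@[simp] theorem zero_im : (0 : Cx V).im = 0 := rfl
@[simp] theorem neg_re (v : Cx V) : (-v).re = -v.re := rfl
@[simp] theorem neg_im (v : Cx V) : (-v).im = -v.im := rfl
@[simp] theorem sub_re (v w : Cx V) : (v - w).re = v.re - w.re := rfl
@[simp] theorem sub_im (v w : Cx V) : (v - w).im = v.im - w.im := rfl
@[simp] theorem smul_re (z : ℂ) (v : Cx V) : (z • v).re = z.re • v.re - z.im • v.im := rfl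
@[simp] theorem smul_im (z : ℂ) (v : Cx V) : (z • v).im = z.re • v.im + z.im • v.re := rfl

instance : Module ℂ (Cx V) where
  one_smul v := by ext <;> simp
  mul_smul z w v := by
    ext <;> simp only [smul_re, smul_im, Complex.mul_re, Complex.mul_im] <;> module
  smul_zero z := by ext <;> simp
  smul_add z v w := by
    ext <;> simp only [smul_re, smul_im, add_re, add_im] <;> module
  add_smul z w v := by
    ext <;> simp only [smul_re, smul_im, add_re, add_im, Complex.add_re, Complex.add_im] <;> module
  zero_smul v := by ext <;> simp

/-- The complex-linear extension of a real-linear map. -/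
def map (f : V →ₗ[ℝ] W) : Cx V →ₗ[ℂ] Cx W where
  toFun v := ⟨f v.re, f v.im⟩
  map_add' v w := by ext <;> simp
  map_smul' z v := by ext <;> simp

@[simp] theorem map_re (f : V →ₗ[ℝ] W) (v : Cx V) : (map f v).re = f v.re := rfl
@[simp] theorem map_im (f : V →ₗ[ℝ] W) (v : Cx V) : (map f v).im = f v.im := rfl

/-- The complex-bilinear extension of a real bilinear form. -/
def bilin (B : V →ₗ[ℝ] V →ₗ[ℝ] ℝ) : Cx V →ₗ[ℂ] Cx V →ₗ[ℂ] ℂ :=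
  LinearMap.mk₂ ℂ
    (fun v w => ⟨B v.re w.re - B v.im w.im, B v.re w.im + B v.im w.re⟩)
    (by intro v v' w; apply Complex.ext <;> simp <;> ring)
    (by intro z v w; apply Complex.ext <;> simp <;> ring)
    (by intro v w w'; apply Complex.ext <;> simp <;> ring)
    (by intro z v w; apply Complex.ext <;> simp <;> ring)

/-- The complex-linear extension of a complex-valued real-linear form (that is, of an element
of `V^* ⊗ ℂ`). -/
def eval (ξ : V →ₗ[ℝ] ℂ) : Cx V →ₗ[ℂ] ℂ where
  toFun v := ξ v.re + Complex.I * ξ v.im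
  map_add' v w := by simp; ring
  map_smul' z v := by
    have h : Complex.I * Complex.I = -1 := Complex.I_mul_I
    have hz : z = z.re + z.im * Complex.I := (Complex.re_add_im z).symm
    simp only [smul_re, smul_im, map_sub, map_add, map_smul, Complex.real_smul, RingHom.id_apply,
      smul_eq_mul]
    conv_rhs => rw [hz]
    linear_combination (-(z.im : ℂ) * ξ v.im) * h

/-- The eigenspace of the complex-linear extension of `J` for the eigenvalue `c`. -/
def eig (J : V →ₗ[ℝ] V) (c : ℂ) : Submodule ℂ (Cx V) := Module.End.eigenspace (map J) c

theorem mem_eig {J : V →ₗ[ℝ] V} {c : ℂ} {v : Cx V} : v ∈ eig J c ↔ map J v = c • v :=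
  Module.End.mem_eigenspace_iff

/-- The projection `(1 - i I) / 2` onto the `+i`-eigenspace of a complex structure `I`. -/
def proj10 (I : V →ₗ[ℝ] V) : Cx V →ₗ[ℂ] Cx V :=
  (1 / 2 : ℂ) • (LinearMap.id - Complex.I • map I)

/-- The forms of type `(1,0)`: those with `ξ (I v) = i ξ v`. -/
def form10 (I : V →ₗ[ℝ] V) : Submodule ℂ (V →ₗ[ℝ] ℂ) where
  carrier := {ξ | ∀ v, ξ (I v) = Complex.I * ξ v}
  add_mem' := by
    intro ξ η hξ hη v
    simp only [LinearMap.add_apply, hξ v, hη v]; ring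
  zero_mem' := by intro v; simp
  smul_mem' := by
    intro z ξ hξ v
    simp only [LinearMap.smul_apply, hξ v, smul_eq_mul]; ring

/-- The complex-linear extension of a real-linear map `V^* → W` to `V^* ⊗ ℂ → W ⊗ ℂ`. -/
def mapDual (j : (V →ₗ[ℝ] ℝ) →ₗ[ℝ] W) : (V →ₗ[ℝ] ℂ) →ₗ[ℂ] Cx W where
  toFun ξ := ⟨j (Complex.reLm ∘ₗ ξ), j (Complex.imLm ∘ₗ ξ)⟩
  map_add' ξ η := by ext <;> simp [LinearMap.comp_add]
  map_smul' z ξ := by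
    have h1 : Complex.reLm ∘ₗ (z • ξ) = z.re • (Complex.reLm ∘ₗ ξ) - z.im • (Complex.imLm ∘ₗ ξ) := by
      ext v; simp
    have h2 : Complex.imLm ∘ₗ (z • ξ) = z.re • (Complex.imLm ∘ₗ ξ) + z.im • (Complex.reLm ∘ₗ ξ) := by
      ext v; simp
    ext <;> simp [h1, h2]

/-- A real form, viewed as a complex form. -/
def ofRealForm (ξ : V →ₗ[ℝ] ℝ) : V →ₗ[ℝ] ℂ := Complex.ofRealCLM.toLinearMap ∘ₗ ξ

end Cx

/-! ### Linear algebra of reduction and of the Baer sum -/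

section LinearAlgebra

variable {W : Type*} [AddCommGroup W] [Module ℂ W]

/-- The orthogonal complement `D^⊥`. -/
abbrev perp (B : W →ₗ[ℂ] W →ₗ[ℂ] ℂ) (D : Submodule ℂ W) : Submodule ℂ W := D.orthogonalBilin B

/-- The reduction `D^⊥ / D`. -/
abbrev Red (B : W →ₗ[ℂ] W →ₗ[ℂ] ℂ) (D : Submodule ℂ W) : Type _ :=
  (perp B D) ⧸ (D.submoduleOf (perp B D))

/-- The reduction `(L ∩ D^⊥ + D) / D` of `L`. -/
def redSub (B : W →ₗ[ℂ] W →ₗ[ℂ] ℂ) (D L : Submodule ℂ W) : Submodule ℂ (Red B D) :=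
  (((L ⊓ perp B D) ⊔ D).submoduleOf (perp B D)).map (D.submoduleOf (perp B D)).mkQ

/-- The preimage in `D^⊥` of a subspace of `D^⊥ / D`. -/
def redPre (B : W →ₗ[ℂ] W →ₗ[ℂ] ℂ) (D : Submodule ℂ W) (A : Submodule ℂ (Red B D)) :
    Submodule ℂ W :=
  (A.comap (D.submoduleOf (perp B D)).mkQ).map (perp B D).subtype

variable {E₁ E₂ T T' : Type*} [AddCommGroup E₁] [Module ℂ E₁] [AddCommGroup E₂] [Module ℂ E₂]
  [AddCommGroup T] [Module ℂ T] [AddCommGroup T'] [Module ℂ T']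

/-- The fiber product `E₁ ⊕_T E₂`. -/
def fiberProd (p₁ : E₁ →ₗ[ℂ] T) (p₂ : E₂ →ₗ[ℂ] T) : Submodule ℂ (E₁ × E₂) :=
  LinearMap.eqLocus (p₁ ∘ₗ LinearMap.fst ℂ E₁ E₂) (p₂ ∘ₗ LinearMap.snd ℂ E₁ E₂)

/-- The subspace `K = {(-j₁ ξ, j₂ ξ)}`, for the inclusions `j₁, j₂` of the cotangent space. -/
def baerK (j₁ : T' →ₗ[ℂ] E₁) (j₂ : T' →ₗ[ℂ] E₂) : Submodule ℂ (E₁ × E₂) :=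
  LinearMap.range ((-j₁).prod j₂)

/-- The Baer sum `E₁ ⊠ E₂ = (E₁ ⊕_T E₂) / K` of two extensions of `T` by `T'`. -/
abbrev BaerSum (p₁ : E₁ →ₗ[ℂ] T) (p₂ : E₂ →ₗ[ℂ] T) (j₁ : T' →ₗ[ℂ] E₁) (j₂ : T' →ₗ[ℂ] E₂) :
    Type _ :=
  (fiberProd p₁ p₂) ⧸ ((baerK j₁ j₂).submoduleOf (fiberProd p₁ p₂))

/-- The Baer sum `D₁ ⊠ D₂ = (D₁ ⊕_T D₂ + K) / K` of two subspaces `D₁ ⊆ E₁`, `D₂ ⊆ E₂`. -/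
def baerSub (p₁ : E₁ →ₗ[ℂ] T) (p₂ : E₂ →ₗ[ℂ] T) (j₁ : T' →ₗ[ℂ] E₁) (j₂ : T' →ₗ[ℂ] E₂)
    (D₁ : Submodule ℂ E₁) (D₂ : Submodule ℂ E₂) : Submodule ℂ (BaerSum p₁ p₂ j₁ j₂) :=
  (((D₁.prod D₂ ⊓ fiberProd p₁ p₂) ⊔ baerK j₁ j₂).submoduleOf (fiberProd p₁ p₂)).map
    ((baerK j₁ j₂).submoduleOf (fiberProd p₁ p₂)).mkQ

/-- The graph `{τ ξ + ξ}` of `τ : T' → T` in `E^⊤ ⊠ E = T ⊕ T'`. The transpose `E^⊤` has the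
same anchor as `E`, while its inclusion of `T'` (the dual of the anchor with respect to the
opposite pairing) is `-j`. The element `X + ξ` of `T ⊕ T'` is the class of `(e, e + j ξ)` for any
`e` over `X`: the vectors sit diagonally, and `T'` is included through the second summand. -/
def graphInBaer (p : W →ₗ[ℂ] T) (j : T' →ₗ[ℂ] W) (τ : T' → T) : Set (BaerSum p p (-j) j) :=
  {q | ∃ (ξ : T') (e : W) (h : (e, e + j ξ) ∈ fiberProd p p),
    p e = τ ξ ∧ q = ((baerK (-j) j).submoduleOf (fiberProd p p)).mkQ ⟨(e, e + j ξ), h⟩}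

end LinearAlgebra

/-! ### Vector fields, forms and derivatives on a manifold -/

section Manifold

variable {n : ℕ} {M : Type*} [TopologicalSpace M] [ChartedSpace (EuclideanSpace ℝ (Fin n)) M]
  [IsManifold (𝓡 n) ∞ M]

/-- Smoothness of a vector field. -/
def SmoothVF (X : ∀ x : M, TangentSpace (𝓡 n) x) : Prop :=
  ContMDiff (𝓡 n) (𝓡 n).tangent ∞ (fun x => (⟨x, X x⟩ : TangentBundle (𝓡 n) M))

/-- Smoothness of a complex vector field. -/
def SmoothCVF (V : ∀ x : M, Cx (TangentSpace (𝓡 n) x)) : Prop :=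
  SmoothVF (fun x => (V x).re) ∧ SmoothVF (fun x => (V x).im)

/-- Smoothness of a real 1-form. -/
def SmoothForm (ξ : ∀ x : M, TangentSpace (𝓡 n) x →ₗ[ℝ] ℝ) : Prop :=
  ∀ X : ∀ x : M, TangentSpace (𝓡 n) x, SmoothVF X →
    ContMDiff (𝓡 n) 𝓘(ℝ, ℝ) ∞ (fun x => ξ x (X x))

/-- Smoothness of a complex 1-form. -/
def SmoothCForm (ξ : ∀ x : M, TangentSpace (𝓡 n) x →ₗ[ℝ] ℂ) : Prop :=
  ∀ X : ∀ x : M, TangentSpace (𝓡 n) x, SmoothVF X →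
    ContMDiff (𝓡 n) 𝓘(ℝ, ℂ) ∞ (fun x => ξ x (X x))

/-- The differential of a complex function. -/
def cdiff (f : M → ℂ) (x : M) : TangentSpace (𝓡 n) x →ₗ[ℝ] ℂ :=
  (mvfderiv (𝓡 n) f x).toLinearMap

/-- The derivative `V f` of a complex function along a complex vector field. -/
def dirDeriv (V : ∀ x : M, Cx (TangentSpace (𝓡 n) x)) (f : M → ℂ) (x : M) : ℂ :=
  Cx.eval (cdiff f x) (V x)

/-- The Lie bracket of complex vector fields. -/
def cLie (V W : ∀ x : M, Cx (TangentSpace (𝓡 n) x)) (x : M) : Cx (TangentSpace (𝓡 n) x) :=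
  ⟨mlieBracket (𝓡 n) (fun y => (V y).re) (fun y => (W y).re) x
      - mlieBracket (𝓡 n) (fun y => (V y).im) (fun y => (W y).im) x,
    mlieBracket (𝓡 n) (fun y => (V y).re) (fun y => (W y).im) x
      + mlieBracket (𝓡 n) (fun y => (V y).im) (fun y => (W y).re) x⟩

/-- The value `(L_V ξ)(W) = V (ξ W) - ξ [V, W]` of the Lie derivative of a complex 1-form. -/
def lieForm (V : ∀ x : M, Cx (TangentSpace (𝓡 n) x)) (ξ : ∀ x : M, TangentSpace (𝓡 n) x →ₗ[ℝ] ℂ)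
    (W : ∀ x : M, Cx (TangentSpace (𝓡 n) x)) (x : M) : ℂ :=
  dirDeriv V (fun y => Cx.eval (ξ y) (W y)) x - Cx.eval (ξ x) (cLie V W x)

/-- `I` is an (integrable) complex structure on `M`, so that `(M, I)` is a complex manifold: a
smooth endomorphism of the tangent bundle with `I² = -1` and with involutive `+i`-eigenbundle. -/
structure IsComplexStructure
    (I : ∀ x : M, TangentSpace (𝓡 n) x →ₗ[ℝ] TangentSpace (𝓡 n) x) : Prop where
  smooth : ∀ X : ∀ x : M, TangentSpace (𝓡 n) x, SmoothVF X → SmoothVF (fun x => I x (X x))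
  sq : ∀ x v, I x (I x v) = -v
  involutive : ∀ V W : ∀ x : M, Cx (TangentSpace (𝓡 n) x), SmoothCVF V → SmoothCVF W →
    (∀ x, V x ∈ Cx.eig (I x) Complex.I) → (∀ x, W x ∈ Cx.eig (I x) Complex.I) →
    ∀ x, cLie V W x ∈ Cx.eig (I x) Complex.I

/-- The bracket `{f, g} = σ(df, dg)` of functions defined by a complex bivector field. -/
def poissonBracket
    (σ : ∀ x : M, (TangentSpace (𝓡 n) x →ₗ[ℝ] ℂ) →ₗ[ℂ] Cx (TangentSpace (𝓡 n) x))
    (f g : M → ℂ) (x : M) : ℂ :=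
  Cx.eval (cdiff g x) (σ x (cdiff f x))

/-- `σ` is a holomorphic Poisson structure on `(M, I)`. A complex bivector field is viewed as the
skew map `σ : T^* ⊗ ℂ → T ⊗ ℂ`, with `σ(ξ, η) = η(σ ξ)`. It is a section of `∧² T_{1,0}`
(`skew` and `type`), smooth, holomorphic, and has vanishing Schouten bracket with itself, that is,
its bracket of functions satisfies the Jacobi identity. The form of type `(2,0)` in
`ξ, η ↦ (L_V σ)(ξ, η) = V(σ(ξ, η)) - σ(L_V ξ, η) - σ(ξ, L_V η)`, for `V` of type `(0,1)`, is
`(∂̄_V σ)(ξ, η)`, where `σ(L_V ξ, η) = -(L_V ξ)(σ η)` and `σ(ξ, L_V η) = (L_V η)(σ ξ)`. -/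
structure IsHolomorphicPoisson
    (I : ∀ x : M, TangentSpace (𝓡 n) x →ₗ[ℝ] TangentSpace (𝓡 n) x)
    (σ : ∀ x : M, (TangentSpace (𝓡 n) x →ₗ[ℝ] ℂ) →ₗ[ℂ] Cx (TangentSpace (𝓡 n) x)) : Prop where
  skew : ∀ x ξ η, Cx.eval η (σ x ξ) = -Cx.eval ξ (σ x η)
  type : ∀ x ξ, σ x ξ ∈ Cx.eig (I x) Complex.I
  smooth : ∀ ξ : ∀ x : M, TangentSpace (𝓡 n) x →ₗ[ℝ] ℂ, SmoothCForm ξ →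
    SmoothCVF (fun x => σ x (ξ x))
  holomorphic : ∀ V : ∀ x : M, Cx (TangentSpace (𝓡 n) x), SmoothCVF V →
    (∀ x, V x ∈ Cx.eig (I x) (-Complex.I)) →
    ∀ ξ η : ∀ x : M, TangentSpace (𝓡 n) x →ₗ[ℝ] ℂ, SmoothCForm ξ → SmoothCForm η →
    (∀ x, ξ x ∈ Cx.form10 (I x)) → (∀ x, η x ∈ Cx.form10 (I x)) →
    ∀ x, dirDeriv V (fun y => Cx.eval (η y) (σ y (ξ y))) x
      - (-lieForm V ξ (fun y => σ y (η y)) x) - lieForm V η (fun y => σ y (ξ y)) x = 0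
  jacobi : ∀ f g h : M → ℂ, ContMDiff (𝓡 n) 𝓘(ℝ, ℂ) ∞ f → ContMDiff (𝓡 n) 𝓘(ℝ, ℂ) ∞ g →
    ContMDiff (𝓡 n) 𝓘(ℝ, ℂ) ∞ h → ∀ x,
    poissonBracket σ f (poissonBracket σ g h) x + poissonBracket σ g (poissonBracket σ h f) x
      + poissonBracket σ h (poissonBracket σ f g) x = 0

end Manifold

/-! ### Exact Courant algebroids -/

section Courant

variable {n : ℕ} {M : Type*} [TopologicalSpace M] [ChartedSpace (EuclideanSpace ℝ (Fin n)) M]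
  [IsManifold (𝓡 n) ∞ M]
  {F : Type*} [NormedAddCommGroup F] [NormedSpace ℝ F]
  {E : M → Type*} [TopologicalSpace (TotalSpace F E)] [∀ x, TopologicalSpace (E x)]
  [∀ x, AddCommGroup (E x)] [∀ x, Module ℝ (E x)] [FiberBundle F E] [VectorBundle ℝ F E]

/-- The product of a smooth function and a smooth section. -/
def smulSection (f : C^∞⟮𝓡 n, M; 𝓘(ℝ, ℝ), ℝ⟯) (e : Cₛ^∞⟮𝓡 n; F, E⟯) : Cₛ^∞⟮𝓡 n; F, E⟯ :=
  ⟨fun x => f x • e x, f.contMDiff.smul_section e.contMDiff⟩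

/-- A real exact Courant algebroid `0 → T^*M → E → TM → 0` over `M`. The pairing is an
isomorphism of extensions `q : E → E^*`, that is, `⟨ι ξ, e⟩ = ξ (anchor e)`; the bracket is the
(non-skew) Dorfman form of the Courant bracket on smooth sections, with
`[e, e] = (1/2) ι d⟨e, e⟩`. -/
structure ExactCourantAlgebroid (n : ℕ) {M : Type*} [TopologicalSpace M]
    [ChartedSpace (EuclideanSpace ℝ (Fin n)) M] [IsManifold (𝓡 n) ∞ M]
    (F : Type*) [NormedAddCommGroup F] [NormedSpace ℝ F]
    (E : M → Type*) [TopologicalSpace (TotalSpace F E)] [∀ x, TopologicalSpace (E x)]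
    [∀ x, AddCommGroup (E x)] [∀ x, Module ℝ (E x)] [FiberBundle F E] [VectorBundle ℝ F E] where
  /-- the inclusion of the cotangent bundle -/
  ι : ∀ x : M, (TangentSpace (𝓡 n) x →ₗ[ℝ] ℝ) →ₗ[ℝ] E x
  /-- the anchor -/
  anchor : ∀ x : M, E x →ₗ[ℝ] TangentSpace (𝓡 n) x
  /-- the symmetric pairing -/
  pairing : ∀ x : M, E x →ₗ[ℝ] E x →ₗ[ℝ] ℝ
  /-- the bracket of sections -/
  bracket : Cₛ^∞⟮𝓡 n; F, E⟯ →ₗ[ℝ] Cₛ^∞⟮𝓡 n; F, E⟯ →ₗ[ℝ] Cₛ^∞⟮𝓡 n; F, E⟯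
  ι_smooth : ∀ ξ : ∀ x : M, TangentSpace (𝓡 n) x →ₗ[ℝ] ℝ, SmoothForm ξ →
    ContMDiff (𝓡 n) ((𝓡 n).prod 𝓘(ℝ, F)) ∞ (fun x => TotalSpace.mk' F x (ι x (ξ x)))
  anchor_smooth : ∀ e : Cₛ^∞⟮𝓡 n; F, E⟯, SmoothVF (fun x => anchor x (e x))
  pairing_smooth : ∀ e e' : Cₛ^∞⟮𝓡 n; F, E⟯,
    ContMDiff (𝓡 n) 𝓘(ℝ, ℝ) ∞ (fun x => pairing x (e x) (e' x))
  ι_injective : ∀ x, Function.Injective (ι x)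
  exact : ∀ x, Function.Exact (ι x) (anchor x)
  anchor_surjective : ∀ x, Function.Surjective (anchor x)
  pairing_symm : ∀ x e e', pairing x e e' = pairing x e' e
  pairing_nondegenerate : ∀ x e, (∀ e', pairing x e e' = 0) → e = 0
  pairing_ι : ∀ x ξ e, pairing x (ι x ξ) e = ξ (anchor x e)
  bracket_jacobi : ∀ e₁ e₂ e₃ : Cₛ^∞⟮𝓡 n; F, E⟯,
    bracket e₁ (bracket e₂ e₃) = bracket (bracket e₁ e₂) e₃ + bracket e₂ (bracket e₁ e₃)
  anchor_bracket : ∀ (e₁ e₂ : Cₛ^∞⟮𝓡 n; F, E⟯) (x : M),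
    anchor x (bracket e₁ e₂ x) = mlieBracket (𝓡 n) (fun y => anchor y (e₁ y)) (fun y => anchor y (e₂ y)) x
  bracket_leibniz : ∀ (e₁ e₂ : Cₛ^∞⟮𝓡 n; F, E⟯) (f : C^∞⟮𝓡 n, M; 𝓘(ℝ, ℝ), ℝ⟯) (x : M),
    bracket e₁ (smulSection f e₂) x
      = f x • bracket e₁ e₂ x + (mvfderiv (𝓡 n) f x (anchor x (e₁ x))) • e₂ x
  bracket_pairing : ∀ (e₁ e₂ e₃ : Cₛ^∞⟮𝓡 n; F, E⟯) (x : M),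
    mvfderiv (𝓡 n) (fun y => pairing y (e₂ y) (e₃ y)) x (anchor x (e₁ x))
      = pairing x (bracket e₁ e₂ x) (e₃ x) + pairing x (e₂ x) (bracket e₁ e₃ x)
  bracket_self : ∀ (e : Cₛ^∞⟮𝓡 n; F, E⟯) (x : M),
    bracket e e x
      = (1 / 2 : ℝ) • ι x (mvfderiv (𝓡 n) (fun y => pairing y (e y) (e y)) x).toLinearMap

/-- The value at `x` of a complex section, given by its real and imaginary parts. -/
def csec (e : Cx (Cₛ^∞⟮𝓡 n; F, E⟯)) (x : M) : Cx (E x) := ⟨e.re x, e.im x⟩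

namespace ExactCourantAlgebroid

variable (𝓔 : ExactCourantAlgebroid n F E)

/-- The complex-bilinear pairing on `E ⊗ ℂ`. -/
def pairingC (x : M) : Cx (E x) →ₗ[ℂ] Cx (E x) →ₗ[ℂ] ℂ := Cx.bilin (𝓔.pairing x)

/-- The complex-bilinear extension of the bracket to sections of `E ⊗ ℂ`. -/
def bracketC (a b : Cx (Cₛ^∞⟮𝓡 n; F, E⟯)) : Cx (Cₛ^∞⟮𝓡 n; F, E⟯) :=
  ⟨𝓔.bracket a.re b.re - 𝓔.bracket a.im b.im, 𝓔.bracket a.re b.im + 𝓔.bracket a.im b.re⟩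

/-- A generalized complex structure: an orthogonal bundle endomorphism with square `-1` whose
`+i`-eigenbundle is involutive. -/
structure IsGeneralizedComplex (J : ∀ x : M, E x →ₗ[ℝ] E x) : Prop where
  smooth : ∀ e : Cₛ^∞⟮𝓡 n; F, E⟯,
    ContMDiff (𝓡 n) ((𝓡 n).prod 𝓘(ℝ, F)) ∞ (fun x => TotalSpace.mk' F x (J x (e x)))
  sq : ∀ x e, J x (J x e) = -e
  orthogonal : ∀ x e e', 𝓔.pairing x (J x e) (J x e') = 𝓔.pairing x e e'
  involutive : ∀ a b : Cx (Cₛ^∞⟮𝓡 n; F, E⟯),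
    (∀ x, csec a x ∈ Cx.eig (J x) Complex.I) → (∀ x, csec b x ∈ Cx.eig (J x) Complex.I) →
    ∀ x, csec (𝓔.bracketC a b) x ∈ Cx.eig (J x) Complex.I

/-- The section `e` of `E ⊗ ℂ` represents, over `U`, a holomorphic section of the reduction
`D^⊥ / D`, whose holomorphic structure is `∂̄_X [e] = [[X̃, e]]` for the lift `X̃` to `D` of a
vector field `X` of type `(0,1)`. -/
def IsHolomorphicSection (D : ∀ x : M, Submodule ℂ (Cx (E x))) (U : Set M)
    (e : Cx (Cₛ^∞⟮𝓡 n; F, E⟯)) : Prop :=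
  (∀ x ∈ U, csec e x ∈ perp (𝓔.pairingC x) (D x)) ∧
    ∀ d : Cx (Cₛ^∞⟮𝓡 n; F, E⟯), (∀ x, csec d x ∈ D x) →
      ∀ x ∈ U, csec (𝓔.bracketC d e) x ∈ D x

/-- `A` is a holomorphic Dirac structure in the reduction `D^⊥ / D`: a smooth subbundle, maximal
isotropic, preserved by the operators `∂̄_X`, and closed under the bracket of local holomorphic
sections. Sections of `D^⊥ / D` are written through representatives in `D^⊥`. -/
structure IsHolomorphicDirac (D : ∀ x : M, Submodule ℂ (Cx (E x)))
    (A : ∀ x : M, Submodule ℂ (Red (𝓔.pairingC x) (D x))) : Prop where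
  smooth : ∀ x, ∀ v ∈ redPre (𝓔.pairingC x) (D x) (A x), ∃ e : Cx (Cₛ^∞⟮𝓡 n; F, E⟯),
    (∀ y, csec e y ∈ redPre (𝓔.pairingC y) (D y) (A y)) ∧ csec e x = v
  maximal_isotropic : ∀ x, ∀ v ∈ perp (𝓔.pairingC x) (D x),
    v ∈ redPre (𝓔.pairingC x) (D x) (A x) ↔
      ∀ w ∈ redPre (𝓔.pairingC x) (D x) (A x), 𝓔.pairingC x v w = 0
  holomorphic : ∀ d e : Cx (Cₛ^∞⟮𝓡 n; F, E⟯), (∀ x, csec d x ∈ D x) →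
    (∀ x, csec e x ∈ redPre (𝓔.pairingC x) (D x) (A x)) →
    ∀ x, csec (𝓔.bracketC d e) x ∈ redPre (𝓔.pairingC x) (D x) (A x)
  involutive : ∀ U : Set M, IsOpen U → ∀ a b : Cx (Cₛ^∞⟮𝓡 n; F, E⟯),
    𝓔.IsHolomorphicSection D U a → 𝓔.IsHolomorphicSection D U b →
    (∀ x ∈ U, csec a x ∈ redPre (𝓔.pairingC x) (D x) (A x)) →
    (∀ x ∈ U, csec b x ∈ redPre (𝓔.pairingC x) (D x) (A x)) →
    ∀ x ∈ U, csec (𝓔.bracketC a b) x ∈ redPre (𝓔.pairingC x) (D x) (A x)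

end ExactCourantAlgebroid

/-! ### Generalized Kähler structures -/

/-- A generalized Kähler structure `(J₊, J₋)` on an exact Courant algebroid. -/
structure GeneralizedKahler (𝓔 : ExactCourantAlgebroid n F E) where
  /-- the generalized complex structure `J₊` -/
  Jp : ∀ x : M, E x →ₗ[ℝ] E x
  /-- the generalized complex structure `J₋` -/
  Jm : ∀ x : M, E x →ₗ[ℝ] E x
  isGC_p : 𝓔.IsGeneralizedComplex Jp
  isGC_m : 𝓔.IsGeneralizedComplex Jm
  comm : ∀ x e, Jp x (Jm x e) = Jm x (Jp x e)
  pos : ∀ x e, e ≠ 0 → 0 < 𝓔.pairing x (Jp x e) (Jm x e)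

namespace GeneralizedKahler

variable {𝓔 : ExactCourantAlgebroid n F E} (K : GeneralizedKahler 𝓔)

/-- The bundle `C_±`, the `±1`-eigenbundle of the generalized metric `G = -J₊ J₋`. -/
def C (s : Sgn) (x : M) : Submodule ℝ (E x) :=
  Module.End.eigenspace (-(K.Jp x ∘ₗ K.Jm x)) s.val

theorem mem_C {s : Sgn} {x : M} {e : E x} :
    e ∈ K.C s x ↔ K.Jp x (K.Jm x e) = -(s.val • e) := by
  unfold C
  rw [Module.End.mem_eigenspace_iff, LinearMap.neg_apply, LinearMap.comp_apply, neg_eq_iff_eq_neg]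

theorem pairing_metric {s : Sgn} {x : M} {e : E x} (he : e ∈ K.C s x) :
    𝓔.pairing x (K.Jp x e) (K.Jm x e) = s.val * 𝓔.pairing x e e := by
  rw [← K.isGC_p.orthogonal, K.isGC_p.sq, K.mem_C.1 he]
  simp

theorem eq_zero_of_isotropic {s : Sgn} {x : M} {e : E x} (he : e ∈ K.C s x)
    (h0 : 𝓔.pairing x e e = 0) : e = 0 := by
  by_contra hne
  have := K.pos x e hne
  rw [K.pairing_metric he, h0, mul_zero] at this
  exact lt_irrefl _ this

theorem pairing_C_orthogonal {s : Sgn} {x : M} {a b : E x} (ha : a ∈ K.C s x)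
    (hb : K.Jp x (K.Jm x b) = s.val • b) : 𝓔.pairing x a b = 0 := by
  have h : 𝓔.pairing x (K.Jp x (K.Jm x a)) (K.Jp x (K.Jm x b)) = 𝓔.pairing x a b := by
    rw [K.isGC_p.orthogonal, K.isGC_m.orthogonal]
  rw [K.mem_C.1 ha, hb] at h
  simp only [map_neg, map_smul, LinearMap.neg_apply, LinearMap.smul_apply, smul_eq_mul] at h
  have := s.val_mul_val
  linear_combination (-1 / 2 : ℝ) * h - (1 / 2 : ℝ) * 𝓔.pairing x a b * this

theorem metric_sq (x : M) (e : E x) : K.Jp x (K.Jm x (K.Jp x (K.Jm x e))) = e := by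
  rw [← K.comm x (K.Jm x e), K.isGC_p.sq, K.isGC_m.sq, neg_neg]

/-- The anchor restricts to an isomorphism from `C_±` to the tangent bundle. -/
theorem anchor_C_bijective (s : Sgn) (x : M) :
    Function.Bijective ((𝓔.anchor x).domRestrict (K.C s x)) := by
  constructor
  · rw [injective_iff_map_eq_zero]
    rintro ⟨e, he⟩ h
    obtain ⟨ξ, rfl⟩ := (𝓔.exact x e).1 h
    have h0 : 𝓔.pairing x (𝓔.ι x ξ) (𝓔.ι x ξ) = 0 := by
      rw [𝓔.pairing_ι]
      have : 𝓔.anchor x (𝓔.ι x ξ) = 0 := h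
      rw [this, map_zero]
    exact Subtype.ext (K.eq_zero_of_isotropic he h0)
  · rw [← LinearMap.range_eq_top]
    by_contra hne
    obtain ⟨φ, hφ, hle⟩ := Submodule.exists_le_ker_of_lt_top _ (lt_top_iff_ne_top.2 hne)
    have hv : ∀ a ∈ K.C s x, 𝓔.pairing x (𝓔.ι x φ) a = 0 := by
      intro a ha
      rw [𝓔.pairing_ι]
      exact hle ⟨⟨a, ha⟩, rfl⟩
    set v := 𝓔.ι x φ with hvdef
    have hs := s.val_mul_val
    have haC : v - s.val • K.Jp x (K.Jm x v) ∈ K.C s x := by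
      rw [K.mem_C]
      simp only [map_sub, map_smul, K.metric_sq, smul_sub, smul_smul, hs]
      simp
    have hb : K.Jp x (K.Jm x (v + s.val • K.Jp x (K.Jm x v)))
        = s.val • (v + s.val • K.Jp x (K.Jm x v)) := by
      simp only [map_add, map_smul, K.metric_sq, smul_add, smul_smul, hs, one_smul]
      abel
    set a := v - s.val • K.Jp x (K.Jm x v) with ha
    set b := v + s.val • K.Jp x (K.Jm x v) with hbdef
    have hab : a + b = (2 : ℝ) • v := by rw [ha, hbdef, two_smul]; abel
    have h1 : 𝓔.pairing x a (a + b) = 0 := by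
      rw [hab, map_smul, 𝓔.pairing_symm, hv a haC, smul_zero]
    rw [map_add, K.pairing_C_orthogonal haC hb, add_zero] at h1
    have ha0 := K.eq_zero_of_isotropic haC h1
    have hvv : v = s.val • K.Jp x (K.Jm x v) := sub_eq_zero.1 ha0
    have hv0 : 𝓔.pairing x v v = 0 := by
      rw [hvdef, 𝓔.pairing_ι, (𝓔.exact x).apply_apply_eq_zero, map_zero]
    have hv1 : v = 0 := by
      by_contra hne'
      have hp := K.pos x v hne'
      rw [← K.isGC_p.orthogonal, K.isGC_p.sq] at hp
      have h2 : K.Jp x (K.Jm x v) = s.val • v := by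
        conv_rhs => rw [hvv]
        rw [smul_smul, hs, one_smul]
      rw [h2] at hp
      simp [hv0] at hp
    exact hφ (𝓔.ι_injective x (by rw [← hvdef, hv1, map_zero]))

/-- The splitting `s_± : TM → C_± ⊆ E` of the anchor. -/
def split (s : Sgn) (x : M) : TangentSpace (𝓡 n) x →ₗ[ℝ] E x :=
  (K.C s x).subtype ∘ₗ (LinearEquiv.ofBijective _ (K.anchor_C_bijective s x)).symm.toLinearMap

theorem split_anchor {s : Sgn} {x : M} {e : E x} (he : e ∈ K.C s x) :
    K.split s x (𝓔.anchor x e) = e := by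
  have : (LinearEquiv.ofBijective _ (K.anchor_C_bijective s x)).symm (𝓔.anchor x e) = ⟨e, he⟩ := by
    rw [LinearEquiv.symm_apply_eq]; rfl
  simp [split, this]

/-- The Riemannian metric on `M` for which `s_+ : (TM, g) → (C_+, ⟨,⟩)` is isometric; then
`s_- : (TM, g) → (C_-, -⟨,⟩)` is isometric as well. -/
def g (x : M) : TangentSpace (𝓡 n) x →ₗ[ℝ] TangentSpace (𝓡 n) x →ₗ[ℝ] ℝ :=
  (𝓔.pairing x).compl₁₂ (K.split .plus x) (K.split .plus x)

/-- The complex structures `I_±` on `TM`, transported by `s_±` from the restriction of `J₊`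
to `C_±`. -/
def I (s : Sgn) (x : M) : TangentSpace (𝓡 n) x →ₗ[ℝ] TangentSpace (𝓡 n) x :=
  𝓔.anchor x ∘ₗ K.Jp x ∘ₗ K.split s x

/-- The adjoint `I_±^*` acting on covectors. -/
def Istar (s : Sgn) (x : M) :
    (TangentSpace (𝓡 n) x →ₗ[ℝ] ℝ) →ₗ[ℝ] (TangentSpace (𝓡 n) x →ₗ[ℝ] ℝ) :=
  LinearMap.lcomp ℝ ℝ (K.I s x)

/-- The bundles `ℓ̄_±`, conjugate to `ℓ_+ = L_+ ∩ L_-` and `ℓ_- = L_+ ∩ L̄_-`, where `L_±` is the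
`+i`-eigenbundle of `J_±`. -/
def ellBar (s : Sgn) (x : M) : Submodule ℂ (Cx (E x)) :=
  Cx.eig (K.Jp x) (-Complex.I) ⊓ Cx.eig (K.Jm x) (-(s.val * Complex.I))

theorem anchor_ellBar {s : Sgn} {x : M} {e : Cx (E x)} (he : e ∈ K.ellBar s x) :
    Cx.map (𝓔.anchor x) e ∈ Cx.eig (K.I s x) (-Complex.I) := by
  obtain ⟨h1, h2⟩ := he
  rw [SetLike.mem_coe, Cx.mem_eig] at h1 h2
  have h1r := congrArg Cx.re h1
  have h1i := congrArg Cx.im h1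
  have h2r := congrArg Cx.re h2
  have h2i := congrArg Cx.im h2
  simp at h1r h1i h2r h2i
  have hr : e.re ∈ K.C s x := by
    rw [K.mem_C, h2r, map_smul, h1i, smul_neg]
  have hi : e.im ∈ K.C s x := by
    rw [K.mem_C, h2i, map_neg, map_smul, h1r]
  rw [Cx.mem_eig]
  ext <;> simp [I, K.split_anchor hr, K.split_anchor hi, h1r, h1i]

/-- The anchor `D^⊥ / D → T_{1,0}` of the reduction `E_±` of `E ⊗ ℂ` by `D = ℓ̄_±`, over the
complex manifold `X_± = (M, I_±)`. -/
def redAnchor (s : Sgn) (x : M) :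
    Red (𝓔.pairingC x) (K.ellBar s x) →ₗ[ℂ] Cx (TangentSpace (𝓡 n) x) :=
  Submodule.liftQ _ ((Cx.proj10 (K.I s x) ∘ₗ Cx.map (𝓔.anchor x)) ∘ₗ Submodule.subtype _) (by
    rintro ⟨e, he'⟩ he
    have h := Cx.mem_eig.1 (K.anchor_ellBar (Submodule.mem_comap.1 he))
    simp only [Submodule.subtype_apply] at h
    rw [LinearMap.mem_ker]
    simp only [Cx.proj10, LinearMap.comp_apply, Submodule.subtype_apply, LinearMap.smul_apply,
      LinearMap.sub_apply, LinearMap.id_apply, h, smul_smul]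
    simp)

theorem mapDual_mem_perp (s : Sgn) (x : M) (ξ : Cx.form10 (K.I s x)) :
    Cx.mapDual (𝓔.ι x) ξ.1 ∈ perp (𝓔.pairingC x) (K.ellBar s x) := by
  intro d hd
  have h := Cx.mem_eig.1 (K.anchor_ellBar hd)
  have key : 𝓔.pairingC x d (Cx.mapDual (𝓔.ι x) ξ.1) = Cx.eval ξ.1 (Cx.map (𝓔.anchor x) d) := by
    simp only [ExactCourantAlgebroid.pairingC, Cx.bilin, LinearMap.mk₂_apply]
    simp only [Cx.mapDual, LinearMap.coe_mk, AddHom.coe_mk, 𝓔.pairing_symm x _ (𝓔.ι x _),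
      𝓔.pairing_ι, Cx.eval]
    apply Complex.ext <;> simp <;> ring
  have h2 : Cx.eval ξ.1 (Cx.map (K.I s x) (Cx.map (𝓔.anchor x) d))
      = Complex.I * Cx.eval ξ.1 (Cx.map (𝓔.anchor x) d) := by
    have hx := ξ.2
    simp only [Cx.eval, LinearMap.coe_mk, AddHom.coe_mk, Cx.map_re, Cx.map_im]
    rw [hx, hx]; ring
  rw [h, map_smul, smul_eq_mul, ← key] at h2
  have h3 : 𝓔.pairingC x d (Cx.mapDual (𝓔.ι x) ξ.1) = 0 := by
    have h4 : (2 * Complex.I) * 𝓔.pairingC x d (Cx.mapDual (𝓔.ι x) ξ.1) = 0 := by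
      linear_combination -h2
    exact (mul_eq_zero.1 h4).resolve_left (by simp)
  exact h3

/-- The inclusion `T^*_{1,0} → D^⊥ / D` of the cotangent space in the reduction `E_±`. -/
def redIncl (s : Sgn) (x : M) :
    Cx.form10 (K.I s x) →ₗ[ℂ] Red (𝓔.pairingC x) (K.ellBar s x) :=
  Submodule.mkQ _ ∘ₗ LinearMap.codRestrict _
    (Cx.mapDual (𝓔.ι x) ∘ₗ (Cx.form10 (K.I s x)).subtype) (K.mapDual_mem_perp s x)

/-- `A_±`, the reduction of the `-i`-eigenbundle of `J₊`. -/
def A (s : Sgn) (x : M) : Submodule ℂ (Red (𝓔.pairingC x) (K.ellBar s x)) :=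
  redSub (𝓔.pairingC x) (K.ellBar s x) (Cx.eig (K.Jp x) (-Complex.I))

/-- `B_±`, the reduction of the `∓i`-eigenbundle of `J₋`. -/
def B (s : Sgn) (x : M) : Submodule ℂ (Red (𝓔.pairingC x) (K.ellBar s x)) :=
  redSub (𝓔.pairingC x) (K.ellBar s x) (Cx.eig (K.Jm x) (-(s.val * Complex.I)))

/-- The Baer sum `A_±^⊤ ⊠ B_±` in `E_±^⊤ ⊠ E_±`. The transpose has the same anchor, and the
opposite inclusion of the cotangent space. -/
def baerAB (s : Sgn) (x : M) :
    Submodule ℂ (BaerSum (K.redAnchor s x) (K.redAnchor s x) (-K.redIncl s x) (K.redIncl s x)) :=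
  baerSub (K.redAnchor s x) (K.redAnchor s x) (-K.redIncl s x) (K.redIncl s x)
    (K.A s x) (K.B s x)

end GeneralizedKahler

end Courant

/-- The real part `T^* → T` of a complex bivector `T^* ⊗ ℂ → T ⊗ ℂ`. -/
def rePart {V : Type*} [AddCommGroup V] [Module ℝ V] (σ : (V →ₗ[ℝ] ℂ) →ₗ[ℂ] Cx V)
    (ξ : V →ₗ[ℝ] ℝ) : V :=
  (σ (Cx.ofRealForm ξ)).re

end GenKahler

end

/-! The pointwise statements are linear algebra on `E = C_+ ⊕ C_-`, where each `C_s` is a copy of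
the tangent space through `split`. On `C_s` the map `J₊` becomes `I_s` and `J₋` becomes `s I_s`,
while `ι ξ = s_+ w - s_- w` with `w = g⁻¹ ξ` (`ι_eq`). So the eigenbundle defining `A_s` consists of
the (0,1)-vectors of `I_s` in `C_s` and those of `I_{-s}` in `C_{-s}`. The one defining `B_s` agrees
with it in `C_s` but has the (1,0)-vectors of `I_{-s}` in `C_{-s}`. Their common part is `ellBar`.

Both eigenbundles are Lagrangian, involutive and contain `ellBar`, hence reduce to Dirac structures
(`isHolomorphicDirac_redSub`). Transversality amounts to `D^⊥ = L + L'` for `D = L ∩ L'`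
(`exists_add_of_mem_perp`).

The Baer sum is the graph of the map sending `ξ` to the anchor of the unique `α ∈ A_s` with `α + ι ξ
∈ B_s`. Comparing components in `C_{-s}` forces that component of `α` to be `s` times the (0,1)-part
of `w` for `I_{-s}`. The component in `C_s` is free modulo `ellBar` and is chosen to make the anchor
of type (1,0) for `I_s`. The anchor is then `(s/4)(1 - i I_s)(1 + i I_{-s}) w`. Extended by zero to
the other type this is `bivec`, with real part `(s/8)[I_s, I_{-s}]`. Exchanging the signs reverses
both `s` and the commutator, so both real parts agree.

Holomorphy and the Jacobi identity come from one formula, `lieForm_identity`. For three sections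
`a_i` of one eigenbundle with `a_i + ι ξ_i` in the other, involutivity and isotropy annihilate both
`⟨[a₁, a₂], a₃⟩` and its analogue for the `a_i + ι ξ_i`; the difference is an identity in Lie
derivatives of the `ξ_i`. Taking `a₁` in `ellBar` and `ξ₁ = 0` gives holomorphy, and taking the
(1,0)-parts of three differentials gives Jacobi. -/

noncomputable section

namespace GenKahler

/-! ### Cutoffs, extension of vectors to sections, local frames, and the Lie bracket as a
commutator. -/

section SmoothTools

variable {n : ℕ} {M : Type*} [TopologicalSpace M] [ChartedSpace (EuclideanSpace ℝ (Fin n)) M]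
  [IsManifold (𝓡 n) ∞ M]
  {F : Type*} [NormedAddCommGroup F] [NormedSpace ℝ F]
  {E : M → Type*} [TopologicalSpace (TotalSpace F E)] [∀ x, TopologicalSpace (E x)]
  [∀ x, AddCommGroup (E x)] [∀ x, Module ℝ (E x)] [FiberBundle F E] [VectorBundle ℝ F E]

/-- A smooth cutoff function, equal to `1` near `x` and supported in `U`. -/
theorem exists_cutoff [T2Space M] {U : Set M} (hU : IsOpen U) {x : M} (hx : x ∈ U) :
    ∃ f : C^∞⟮𝓡 n, M; 𝓘(ℝ, ℝ), ℝ⟯, (∀ᶠ y in nhds x, f y = 1) ∧ tsupport f ⊆ U := by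
  obtain ⟨f, -, hf⟩ := (SmoothBumpFunction.nhds_basis_tsupport (I := 𝓡 n) x).mem_iff.1
    (hU.mem_nhds hx)
  exact ⟨⟨f, f.contMDiff⟩, f.eventuallyEq_one, hf⟩

/-- Every vector of a smooth vector bundle extends to a global smooth section. -/
theorem exists_section_eq [T2Space M] [ContMDiffVectorBundle ∞ F E (𝓡 n)] (x : M) (v : E x) :
    ∃ e : Cₛ^∞⟮𝓡 n; F, E⟯, e x = v := by
  set t := trivializationAt F E x
  obtain ⟨f, hf1, hf⟩ := exists_cutoff (n := n) t.open_baseSet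
    (FiberBundle.mem_baseSet_trivializationAt' x)
  -- In the trivialization at `x` the extension of `v` is a constant vector.
  have hs : ContMDiffOn (𝓡 n) ((𝓡 n).prod 𝓘(ℝ, F)) ∞
      (fun y => TotalSpace.mk' F y (FiberBundle.extend F v y)) t.baseSet := by
    rw [t.contMDiffOn_section_baseSet_iff]
    apply (contMDiffOn_const (c := (t ⟨x, v⟩).2)).congr
    intro y hy
    simp only [FiberBundle.extend]
    have := t.apply_mk_symm hy (t ⟨x, v⟩).2
    exact (Prod.ext_iff.1 this).2
  refine ⟨⟨fun y => f y • FiberBundle.extend F v y,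
    ContMDiffOn.smul_section_of_tsupport f.contMDiff.contMDiffOn t.open_baseSet hf hs⟩, ?_⟩
  change f x • FiberBundle.extend F v x = v
  rw [hf1.self_of_nhds, one_smul, FiberBundle.extend_apply_self]

theorem mdifferentiableAt_of_contMDiff {G : Type*} [NormedAddCommGroup G] [NormedSpace ℝ G]
    {f : M → G} (hf : ContMDiff (𝓡 n) 𝓘(ℝ, G) ∞ f) (x : M) :
    MDifferentiableAt (𝓡 n) 𝓘(ℝ, G) f x :=
  (hf x).mdifferentiableAt (by simp)

/-- The derivative of a smooth function along a smooth vector field is smooth. -/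
theorem contMDiff_mvfderiv_apply {G : Type*} [NormedAddCommGroup G] [NormedSpace ℝ G]
    {f : M → G} (hf : ContMDiff (𝓡 n) 𝓘(ℝ, G) ∞ f) {X : ∀ x : M, TangentSpace (𝓡 n) x}
    (hX : SmoothVF X) : ContMDiff (𝓡 n) 𝓘(ℝ, G) ∞ (fun x => mvfderiv (𝓡 n) f x (X x)) := by
  have h1 := (hf.contMDiff_tangentMap (m := ∞) (by simp)).comp hX
  exact (contMDiff_snd_tangentBundle_modelSpace G 𝓘(ℝ, G)).comp h1

theorem SmoothVF.mdifferentiableAt {X : ∀ x : M, TangentSpace (𝓡 n) x} (hX : SmoothVF X) (x : M) :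
    MDifferentiableAt (𝓡 n) (𝓡 n).tangent (fun x => (⟨x, X x⟩ : TangentBundle (𝓡 n) M)) x :=
  (hX x).mdifferentiableAt (by simp)

theorem SmoothVF.add {X Y : ∀ x : M, TangentSpace (𝓡 n) x} (hX : SmoothVF X) (hY : SmoothVF Y) :
    SmoothVF (fun x => X x + Y x) := ContMDiff.add_section hX hY

theorem SmoothVF.sub {X Y : ∀ x : M, TangentSpace (𝓡 n) x} (hX : SmoothVF X) (hY : SmoothVF Y) :
    SmoothVF (fun x => X x - Y x) := ContMDiff.sub_section hX hY

theorem SmoothVF.smul {f : M → ℝ} (hf : ContMDiff (𝓡 n) 𝓘(ℝ, ℝ) ∞ f)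
    {X : ∀ x : M, TangentSpace (𝓡 n) x} (hX : SmoothVF X) :
    SmoothVF (fun x => f x • X x) := ContMDiff.smul_section hf hX

theorem SmoothVF.const_smul (c : ℝ) {X : ∀ x : M, TangentSpace (𝓡 n) x} (hX : SmoothVF X) :
    SmoothVF (fun x => c • X x) := ContMDiff.const_smul_section (a := c) hX

theorem natCast_le_infty (k : ℕ) : (k : ℕ∞ω) ≤ ∞ :=
  WithTop.coe_le_coe.2 (le_top : (k : ℕ∞) ≤ ⊤)

theorem isManifold_minSmoothness (k : ℕ) : IsManifold (𝓡 n) (minSmoothness ℝ k) M := by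
  rw [minSmoothness_of_isRCLikeNormedField]
  exact IsManifold.of_le (natCast_le_infty k)

theorem SmoothVF.mlieBracket {X Y : ∀ x : M, TangentSpace (𝓡 n) x} (hX : SmoothVF X)
    (hY : SmoothVF Y) : SmoothVF (VectorField.mlieBracket (𝓡 n) X Y) := by
  intro x
  have : IsManifold (𝓡 n) (minSmoothness ℝ 2) M := isManifold_minSmoothness 2
  have : IsManifold (𝓡 n) (((⊤ : ℕ∞) : ℕ∞ω) + 1) M := inferInstanceAs (IsManifold (𝓡 n) ∞ M)
  have := ContMDiffAt.mlieBracket_vectorField (m := (⊤ : ℕ∞)) (n := (⊤ : ℕ∞)) (hX x) (hY x)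
    (by simp [minSmoothness_of_isRCLikeNormedField])
  exact this

/-- The Lie bracket of vector fields acts on functions as the commutator of derivations. -/
theorem mvfderiv_mlieBracket [T2Space M] {X Y : ∀ x : M, TangentSpace (𝓡 n) x} (hX : SmoothVF X)
    (hY : SmoothVF Y) {f : M → ℝ} (hf : ContMDiff (𝓡 n) 𝓘(ℝ, ℝ) ∞ f) (x : M) :
    mvfderiv (𝓡 n) f x (VectorField.mlieBracket (𝓡 n) X Y x)
      = mvfderiv (𝓡 n) (fun y => mvfderiv (𝓡 n) f y (Y y)) x (X x)
        - mvfderiv (𝓡 n) (fun y => mvfderiv (𝓡 n) f y (X y)) x (Y x) := by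
  by_cases hv : ∃ v : TangentSpace (𝓡 n) x, v ≠ 0
  -- The formula is read off from the Jacobi identity for `X`, `Y`, `f Z`. After subtracting `f`
  -- times the identity for `X`, `Y`, `Z`, the first-order terms cancel and only a multiple of `Z x`
  -- is left. Its coefficient vanishes because `Z x ≠ 0`.
  · obtain ⟨v, hv⟩ := hv
    obtain ⟨Z, hZ⟩ := exists_section_eq (n := n) (F := EuclideanSpace ℝ (Fin n))
      (E := fun y : M => TangentSpace (𝓡 n) y) x v
    have hZs : SmoothVF (fun y => Z y) := Z.contMDiff
    have bracket_smul : ∀ {W : ∀ x : M, TangentSpace (𝓡 n) x} (hW : SmoothVF W)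
        {h : M → ℝ} (hh : ContMDiff (𝓡 n) 𝓘(ℝ, ℝ) ∞ h)
        {V : ∀ x : M, TangentSpace (𝓡 n) x} (y : M),
        VectorField.mlieBracket (𝓡 n) V (h • W) y
          = mvfderiv (𝓡 n) h y (V y) • W y + h y • VectorField.mlieBracket (𝓡 n) V W y :=
      fun hW h hh V y => mlieBracket_smul_right (mdifferentiableAt_of_contMDiff hh y)
        (hW.mdifferentiableAt y)
    have bracket_two : ∀ {V W : ∀ x : M, TangentSpace (𝓡 n) x} (hV : SmoothVF V)
        (hW : SmoothVF W), VectorField.mlieBracket (𝓡 n) V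
          (VectorField.mlieBracket (𝓡 n) W (f • fun y => Z y)) x
        = mvfderiv (𝓡 n) (fun y => mvfderiv (𝓡 n) f y (W y)) x (V x) • Z x
          + mvfderiv (𝓡 n) f x (W x) • VectorField.mlieBracket (𝓡 n) V (fun y => Z y) x
          + (mvfderiv (𝓡 n) f x (V x) • VectorField.mlieBracket (𝓡 n) W (fun y => Z y) x
          + f x • VectorField.mlieBracket (𝓡 n) V
              (VectorField.mlieBracket (𝓡 n) W (fun y => Z y)) x) := by
      intro V W hV hW
      have h1 : VectorField.mlieBracket (𝓡 n) W (f • fun y => Z y)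
          = (fun y => mvfderiv (𝓡 n) f y (W y)) • (fun y => Z y)
            + f • VectorField.mlieBracket (𝓡 n) W (fun y => Z y) := by
        funext y; exact bracket_smul hZs hf y
      have hfW := contMDiff_mvfderiv_apply hf hW
      have hWZ := hW.mlieBracket hZs
      have h3 := mlieBracket_add_right (V := V) ((hZs.smul hfW).mdifferentiableAt x)
        ((hWZ.smul hf).mdifferentiableAt x)
      rw [h1]
      refine Eq.trans h3 ?_
      refine Eq.trans (congrArg₂ (· + ·) (bracket_smul hZs hfW x) (bracket_smul hWZ hf x)) rfl
    have J : ∀ {W : ∀ x : M, TangentSpace (𝓡 n) x} (hW : SmoothVF W),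
        VectorField.mlieBracket (𝓡 n) X (VectorField.mlieBracket (𝓡 n) Y W) x
        = VectorField.mlieBracket (𝓡 n) (VectorField.mlieBracket (𝓡 n) X Y) W x
          + VectorField.mlieBracket (𝓡 n) Y (VectorField.mlieBracket (𝓡 n) X W) x := by
      intro W hW
      have : IsManifold (𝓡 n) (minSmoothness ℝ 3) M := isManifold_minSmoothness 3
      have h2 : minSmoothness ℝ 2 ≤ ∞ := by
        rw [minSmoothness_of_isRCLikeNormedField]; exact natCast_le_infty 2
      exact leibniz_identity_mlieBracket_apply ((hX x).of_le h2) ((hY x).of_le h2) ((hW x).of_le h2)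
    have h1 := J (hZs.smul hf)
    have h2 := J hZs
    change VectorField.mlieBracket (𝓡 n) X (VectorField.mlieBracket (𝓡 n) Y (f • fun y => Z y)) x
        = VectorField.mlieBracket (𝓡 n) (VectorField.mlieBracket (𝓡 n) X Y) (f • fun y => Z y) x
          + VectorField.mlieBracket (𝓡 n) Y
            (VectorField.mlieBracket (𝓡 n) X (f • fun y => Z y)) x at h1
    rw [bracket_two hX hY, bracket_two hY hX, bracket_smul hZs hf, h2] at h1
    have h3 : (mvfderiv (𝓡 n) f x (VectorField.mlieBracket (𝓡 n) X Y x)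
      - (mvfderiv (𝓡 n) (fun y => mvfderiv (𝓡 n) f y (Y y)) x (X x)
        - mvfderiv (𝓡 n) (fun y => mvfderiv (𝓡 n) f y (X y)) x (Y x))) • Z x = 0 := by
      have h4 := sub_eq_zero.2 h1
      rw [← neg_eq_zero, ← h4]
      module
    rw [hZ] at h3
    exact sub_eq_zero.1 ((smul_eq_zero.1 h3).resolve_right hv)
  -- A zero tangent space leaves no nonzero `Z x`, but then every vector involved is zero.
  · push Not at hv
    rw [hv (X x), hv (Y x), hv (VectorField.mlieBracket (𝓡 n) X Y x)]
    simp

/-- A smooth vector field is, near a point, a combination with smooth coefficients of `n` smooth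
vector fields that restrict to the coordinate basis at that point. -/
theorem exists_local_coeff {x₀ : M} {w : Fin n → ∀ x : M, TangentSpace (𝓡 n) x}
    (hw : ∀ i, SmoothVF (w i))
    (hw₀ : ∀ i, (trivializationAt (EuclideanSpace ℝ (Fin n)) (TangentSpace (𝓡 n)) x₀
      ⟨x₀, w i x₀⟩).2 = EuclideanSpace.single i 1)
    {X : ∀ x : M, TangentSpace (𝓡 n) x} (hX : SmoothVF X) :
    ∃ f : Fin n → M → ℝ, (∀ i, ContMDiffAt (𝓡 n) 𝓘(ℝ, ℝ) ∞ (f i) x₀) ∧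
      ∀ᶠ y in nhds x₀, X y = ∑ i, f i y • w i y := by
  set t := trivializationAt (EuclideanSpace ℝ (Fin n)) (TangentSpace (𝓡 n) : M → Type _) x₀ with ht
  -- The columns of `P y` are the `w i y` in the trivialization at `x₀`. Since `P x₀ = 1`, the
  -- matrix is invertible near `x₀`, and its inverse applied to `X` gives the coefficients.
  let P : M → EuclideanSpace ℝ (Fin n) →L[ℝ] EuclideanSpace ℝ (Fin n) := fun y =>
    ∑ i, ContinuousLinearMap.smulRightL ℝ _ _ (EuclideanSpace.proj i) (t ⟨y, w i y⟩).2
  have hPapp : ∀ y v, P y v = ∑ i, v i • (t ⟨y, w i y⟩).2 := by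
    intro y v
    simp [P]
  have hP₀ : P x₀ = 1 := by
    ext v j
    rw [hPapp]
    simp only [hw₀]
    simp [Finset.sum_apply, Pi.single_apply]
  have hPs : ContMDiffAt (𝓡 n) 𝓘(ℝ, EuclideanSpace ℝ (Fin n) →L[ℝ] EuclideanSpace ℝ (Fin n)) ∞
      P x₀ := by
    refine ContMDiffAt.sum fun i _ => ?_
    exact (ContinuousLinearMap.contMDiff _).contMDiffAt.comp x₀
      ((contMDiffAt_section x₀).1 (hw i x₀))
  have hinv : ContMDiffAt (𝓡 n) 𝓘(ℝ, EuclideanSpace ℝ (Fin n) →L[ℝ] EuclideanSpace ℝ (Fin n)) ∞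
      (fun y => Ring.inverse (P y)) x₀ := by
    have h1 : ContDiffAt ℝ ∞ Ring.inverse (P x₀) := by
      rw [hP₀]; exact contDiffAt_ringInverse ℝ 1
    exact h1.contMDiffAt.comp x₀ hPs
  have hf : ContMDiffAt (𝓡 n) 𝓘(ℝ, EuclideanSpace ℝ (Fin n)) ∞
      (fun y => Ring.inverse (P y) (t ⟨y, X y⟩).2) x₀ :=
    hinv.clm_apply ((contMDiffAt_section x₀).1 (hX x₀))
  refine ⟨fun i y => (Ring.inverse (P y) (t ⟨y, X y⟩).2) i, fun i => ?_, ?_⟩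
  · exact (ContinuousLinearMap.contMDiff
      (EuclideanSpace.proj i : EuclideanSpace ℝ (Fin n) →L[ℝ] ℝ)).contMDiffAt.comp x₀ hf
  · have hu : ∀ᶠ y in nhds x₀, IsUnit (P y) :=
      hPs.continuousAt.eventually (by
        rw [hP₀]
        exact Units.isOpen.mem_nhds isUnit_one)
    filter_upwards [hu, t.open_baseSet.mem_nhds
      (FiberBundle.mem_baseSet_trivializationAt' x₀)] with y hy hyt
    apply (t.linearEquivAt ℝ y hyt).injective
    rw [map_sum]
    simp only [map_smul, Trivialization.linearEquivAt_apply]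
    rw [← hPapp, ← mul_apply_eq_comp, Ring.mul_inverse_cancel _ hy,
      one_apply_eq_self]

end SmoothTools

/-! ### Components of complexified tensors, and conjugation. -/

namespace Cx

variable {V W : Type*} [AddCommGroup V] [Module ℝ V] [AddCommGroup W] [Module ℝ W]

@[simp] theorem bilin_re (B : V →ₗ[ℝ] V →ₗ[ℝ] ℝ) (v w : Cx V) :
    (bilin B v w).re = B v.re w.re - B v.im w.im := rfl

@[simp] theorem bilin_im (B : V →ₗ[ℝ] V →ₗ[ℝ] ℝ) (v w : Cx V) :
    (bilin B v w).im = B v.re w.im + B v.im w.re := rfl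

@[simp] theorem eval_re (ξ : V →ₗ[ℝ] ℂ) (v : Cx V) :
    (eval ξ v).re = (ξ v.re).re - (ξ v.im).im := by
  simp [eval, sub_eq_add_neg]

@[simp] theorem eval_im (ξ : V →ₗ[ℝ] ℂ) (v : Cx V) :
    (eval ξ v).im = (ξ v.re).im + (ξ v.im).re := by
  simp [eval]

@[simp] theorem mapDual_re (j : (V →ₗ[ℝ] ℝ) →ₗ[ℝ] W) (ξ : V →ₗ[ℝ] ℂ) :
    (mapDual j ξ).re = j (Complex.reLm ∘ₗ ξ) := rfl

@[simp] theorem mapDual_im (j : (V →ₗ[ℝ] ℝ) →ₗ[ℝ] W) (ξ : V →ₗ[ℝ] ℂ) :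
    (mapDual j ξ).im = j (Complex.imLm ∘ₗ ξ) := rfl

/-- Complex conjugation on `V ⊗ ℂ`. -/
def conj (v : Cx V) : Cx V := ⟨v.re, -v.im⟩

@[simp] theorem conj_re (v : Cx V) : (conj v).re = v.re := rfl
@[simp] theorem conj_im (v : Cx V) : (conj v).im = -v.im := rfl

theorem conj_mem_eig {J : V →ₗ[ℝ] V} {c : ℂ} {v : Cx V} :
    conj v ∈ eig J (starRingEnd ℂ c) ↔ v ∈ eig J c := by
  simp only [mem_eig, Cx.ext_iff, map_re, map_im, smul_re, smul_im, conj_re, conj_im, map_neg,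
    Complex.conj_re, Complex.conj_im, neg_smul, smul_neg, neg_neg]
  refine and_congr (by rw [sub_eq_add_neg]) ?_
  rw [← neg_inj, neg_add, neg_neg, neg_neg, neg_neg]

end Cx

/-! ### Calculus of complex functions and vector fields through real and imaginary parts. -/

section ComplexCalculus

variable {n : ℕ} {M : Type*} [TopologicalSpace M] [ChartedSpace (EuclideanSpace ℝ (Fin n)) M]
  [IsManifold (𝓡 n) ∞ M]

theorem contMDiff_complex_iff {f : M → ℂ} :
    ContMDiff (𝓡 n) 𝓘(ℝ, ℂ) ∞ f ↔ ContMDiff (𝓡 n) 𝓘(ℝ, ℝ) ∞ (fun x => (f x).re) ∧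
      ContMDiff (𝓡 n) 𝓘(ℝ, ℝ) ∞ (fun x => (f x).im) := by
  refine ⟨fun h => ⟨?_, ?_⟩, fun ⟨h1, h2⟩ => ?_⟩
  · exact (ContinuousLinearMap.contMDiff Complex.reCLM).comp h
  · exact (ContinuousLinearMap.contMDiff Complex.imCLM).comp h
  · have h3 := (ContinuousLinearMap.contMDiff
      (Complex.equivRealProdCLM.symm : ℝ × ℝ →L[ℝ] ℂ) (n := ∞)).comp (h1.prodMk_space h2)
    refine h3.congr fun x => ?_
    simp [Complex.equivRealProdCLM_symm_apply]

theorem mvfderiv_clm_comp {G G' : Type*} [NormedAddCommGroup G] [NormedSpace ℝ G]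
    [NormedAddCommGroup G'] [NormedSpace ℝ G'] (L : G →L[ℝ] G') {f : M → G}
    (hf : ContMDiff (𝓡 n) 𝓘(ℝ, G) ∞ f) (x : M) (v : TangentSpace (𝓡 n) x) :
    mvfderiv (𝓡 n) (fun y => L (f y)) x v = L (mvfderiv (𝓡 n) f x v) := by
  have h := mfderiv_comp_apply x (I := 𝓡 n) (I' := 𝓘(ℝ, G)) (I'' := 𝓘(ℝ, G'))
    (L.contMDiff (n := 1) |>.mdifferentiableAt one_ne_zero) (mdifferentiableAt_of_contMDiff hf x) v
  rw [L.mfderiv_eq] at h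
  exact h

theorem cdiff_re {f : M → ℂ} (hf : ContMDiff (𝓡 n) 𝓘(ℝ, ℂ) ∞ f) (x : M)
    (v : TangentSpace (𝓡 n) x) :
    (cdiff f x v).re = mvfderiv (𝓡 n) (fun y => (f y).re) x v :=
  (mvfderiv_clm_comp Complex.reCLM hf x v).symm

theorem cdiff_im {f : M → ℂ} (hf : ContMDiff (𝓡 n) 𝓘(ℝ, ℂ) ∞ f) (x : M)
    (v : TangentSpace (𝓡 n) x) :
    (cdiff f x v).im = mvfderiv (𝓡 n) (fun y => (f y).im) x v :=
  (mvfderiv_clm_comp Complex.imCLM hf x v).symm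

theorem dirDeriv_re {f : M → ℂ} (hf : ContMDiff (𝓡 n) 𝓘(ℝ, ℂ) ∞ f)
    (V : ∀ x : M, Cx (TangentSpace (𝓡 n) x)) (x : M) :
    (dirDeriv V f x).re = mvfderiv (𝓡 n) (fun y => (f y).re) x (V x).re
      - mvfderiv (𝓡 n) (fun y => (f y).im) x (V x).im := by
  simp [dirDeriv, cdiff_re hf, cdiff_im hf]

theorem dirDeriv_im {f : M → ℂ} (hf : ContMDiff (𝓡 n) 𝓘(ℝ, ℂ) ∞ f)
    (V : ∀ x : M, Cx (TangentSpace (𝓡 n) x)) (x : M) :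
    (dirDeriv V f x).im = mvfderiv (𝓡 n) (fun y => (f y).im) x (V x).re
      + mvfderiv (𝓡 n) (fun y => (f y).re) x (V x).im := by
  simp [dirDeriv, cdiff_re hf, cdiff_im hf]

theorem smoothCForm_cdiff {f : M → ℂ} (hf : ContMDiff (𝓡 n) 𝓘(ℝ, ℂ) ∞ f) :
    SmoothCForm (n := n) (fun x => cdiff f x) := fun _ hX => contMDiff_mvfderiv_apply hf hX

theorem SmoothCForm.re {ξ : ∀ x : M, TangentSpace (𝓡 n) x →ₗ[ℝ] ℂ} (hξ : SmoothCForm ξ) :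
    SmoothForm (fun x => Complex.reLm ∘ₗ ξ x) :=
  fun X hX => (contMDiff_complex_iff.1 (hξ X hX)).1

theorem SmoothCForm.im {ξ : ∀ x : M, TangentSpace (𝓡 n) x →ₗ[ℝ] ℂ} (hξ : SmoothCForm ξ) :
    SmoothForm (fun x => Complex.imLm ∘ₗ ξ x) :=
  fun X hX => (contMDiff_complex_iff.1 (hξ X hX)).2

theorem SmoothCForm.contMDiff_eval {ξ : ∀ x : M, TangentSpace (𝓡 n) x →ₗ[ℝ] ℂ}
    (hξ : SmoothCForm ξ) {V : ∀ x : M, Cx (TangentSpace (𝓡 n) x)} (hV : SmoothCVF V) :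
    ContMDiff (𝓡 n) 𝓘(ℝ, ℂ) ∞ (fun x => Cx.eval (ξ x) (V x)) := by
  have h1 := contMDiff_complex_iff.1 (hξ _ hV.1)
  have h2 := contMDiff_complex_iff.1 (hξ _ hV.2)
  refine contMDiff_complex_iff.2 ⟨?_, ?_⟩
  · exact (h1.1.sub h2.2).congr fun x => Cx.eval_re _ _
  · exact (h1.2.add h2.1).congr fun x => Cx.eval_im _ _

theorem contMDiff_dirDeriv {f : M → ℂ} (hf : ContMDiff (𝓡 n) 𝓘(ℝ, ℂ) ∞ f)
    {V : ∀ x : M, Cx (TangentSpace (𝓡 n) x)} (hV : SmoothCVF V) :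
    ContMDiff (𝓡 n) 𝓘(ℝ, ℂ) ∞ (dirDeriv V f) :=
  (smoothCForm_cdiff hf).contMDiff_eval hV

theorem mvfderiv_add_apply {u v : M → ℝ} (hu : ContMDiff (𝓡 n) 𝓘(ℝ, ℝ) ∞ u)
    (hv : ContMDiff (𝓡 n) 𝓘(ℝ, ℝ) ∞ v) (x : M) (w : TangentSpace (𝓡 n) x) :
    mvfderiv (𝓡 n) (fun y => u y + v y) x w = mvfderiv (𝓡 n) u x w + mvfderiv (𝓡 n) v x w :=
  congrArg (fun L => L w) (mvfderiv_add (mdifferentiableAt_of_contMDiff hu x)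
    (mdifferentiableAt_of_contMDiff hv x))

theorem mvfderiv_sub_apply {u v : M → ℝ} (hu : ContMDiff (𝓡 n) 𝓘(ℝ, ℝ) ∞ u)
    (hv : ContMDiff (𝓡 n) 𝓘(ℝ, ℝ) ∞ v) (x : M) (w : TangentSpace (𝓡 n) x) :
    mvfderiv (𝓡 n) (fun y => u y - v y) x w = mvfderiv (𝓡 n) u x w - mvfderiv (𝓡 n) v x w :=
  congrArg (fun L => L w) (mvfderiv_sub (mdifferentiableAt_of_contMDiff hu x)
    (mdifferentiableAt_of_contMDiff hv x))

/-- The Lie bracket of complex vector fields acts on functions as the commutator. -/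
theorem dirDeriv_cLie [T2Space M] {V W : ∀ x : M, Cx (TangentSpace (𝓡 n) x)} (hV : SmoothCVF V)
    (hW : SmoothCVF W) {f : M → ℂ} (hf : ContMDiff (𝓡 n) 𝓘(ℝ, ℂ) ∞ f) (x : M) :
    Cx.eval (cdiff f x) (cLie V W x) = dirDeriv V (dirDeriv W f) x - dirDeriv W (dirDeriv V f) x := by
  have hr := (contMDiff_complex_iff.1 hf).1
  have hi := (contMDiff_complex_iff.1 hf).2
  have hVf := contMDiff_dirDeriv hf hV
  have hWf := contMDiff_dirDeriv hf hW
  have d := fun {X : ∀ x : M, TangentSpace (𝓡 n) x} (hX : SmoothVF X) {u : M → ℝ}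
    (hu : ContMDiff (𝓡 n) 𝓘(ℝ, ℝ) ∞ u) => contMDiff_mvfderiv_apply hu hX
  have hb := fun {X Y : ∀ x : M, TangentSpace (𝓡 n) x} (hX : SmoothVF X) (hY : SmoothVF Y)
    {u : M → ℝ} (hu : ContMDiff (𝓡 n) 𝓘(ℝ, ℝ) ∞ u) => mvfderiv_mlieBracket hX hY hu x
  apply Complex.ext
  · simp only [Cx.eval_re, cdiff_re hf, cdiff_im hf, cLie, Complex.sub_re, Complex.add_im, dirDeriv_re hVf,
      dirDeriv_re hWf, map_add, map_sub]
    simp only [dirDeriv_re hf, dirDeriv_im hf]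
    rw [mvfderiv_sub_apply (d hW.1 hr) (d hW.2 hi), mvfderiv_sub_apply (d hV.1 hr) (d hV.2 hi),
      mvfderiv_add_apply (d hW.1 hi) (d hW.2 hr), mvfderiv_add_apply (d hV.1 hi) (d hV.2 hr),
      hb hV.1 hW.1 hr, hb hV.2 hW.2 hr, hb hV.1 hW.2 hi, hb hV.2 hW.1 hi]
    ring
  · simp only [Cx.eval_im, cdiff_re hf, cdiff_im hf, cLie, Complex.sub_im, Complex.add_re, dirDeriv_im hVf,
      dirDeriv_im hWf, map_add, map_sub]
    simp only [dirDeriv_re hf, dirDeriv_im hf]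
    rw [mvfderiv_sub_apply (d hW.1 hr) (d hW.2 hi), mvfderiv_sub_apply (d hV.1 hr) (d hV.2 hi),
      mvfderiv_add_apply (d hW.1 hi) (d hW.2 hr), mvfderiv_add_apply (d hV.1 hi) (d hV.2 hr),
      hb hV.1 hW.1 hi, hb hV.2 hW.2 hi, hb hV.1 hW.2 hr, hb hV.2 hW.1 hr]
    ring

theorem SmoothCVF.add {V W : ∀ x : M, Cx (TangentSpace (𝓡 n) x)} (hV : SmoothCVF V)
    (hW : SmoothCVF W) : SmoothCVF (fun x => V x + W x) := ⟨hV.1.add hW.1, hV.2.add hW.2⟩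

theorem SmoothCVF.sub {V W : ∀ x : M, Cx (TangentSpace (𝓡 n) x)} (hV : SmoothCVF V)
    (hW : SmoothCVF W) : SmoothCVF (fun x => V x - W x) := ⟨hV.1.sub hW.1, hV.2.sub hW.2⟩

theorem SmoothCVF.const_smul (c : ℂ) {V : ∀ x : M, Cx (TangentSpace (𝓡 n) x)}
    (hV : SmoothCVF V) : SmoothCVF (fun x => c • V x) :=
  ⟨(hV.1.const_smul c.re).sub (hV.2.const_smul c.im),
    (hV.2.const_smul c.re).add (hV.1.const_smul c.im)⟩

end ComplexCalculus

/-! ### The Dorfman bracket: symmetric part, locality, complexification, and the effect of adding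
1-forms. -/

section CourantCalculus

variable {n : ℕ} {M : Type*} [TopologicalSpace M] [ChartedSpace (EuclideanSpace ℝ (Fin n)) M]
  [IsManifold (𝓡 n) ∞ M]
  {F : Type*} [NormedAddCommGroup F] [NormedSpace ℝ F]
  {E : M → Type*} [TopologicalSpace (TotalSpace F E)] [∀ x, TopologicalSpace (E x)]
  [∀ x, AddCommGroup (E x)] [∀ x, Module ℝ (E x)] [FiberBundle F E] [VectorBundle ℝ F E]

@[simp] theorem csec_re (e : Cx (Cₛ^∞⟮𝓡 n; F, E⟯)) (x : M) : (csec e x).re = e.re x := rfl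
@[simp] theorem csec_im (e : Cx (Cₛ^∞⟮𝓡 n; F, E⟯)) (x : M) : (csec e x).im = e.im x := rfl

theorem csec_add (a b : Cx (Cₛ^∞⟮𝓡 n; F, E⟯)) (x : M) : csec (a + b) x = csec a x + csec b x := rfl

theorem csec_conj (a : Cx (Cₛ^∞⟮𝓡 n; F, E⟯)) (x : M) :
    csec (Cx.conj a) x = Cx.conj (csec a x) := rfl

namespace ExactCourantAlgebroid

variable (𝓔 : ExactCourantAlgebroid n F E)

/-- Polarization of `bracket_self`. It transfers rules for the second argument of the bracket, such
as Leibniz, to the first. -/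
theorem bracket_add_swap (a b : Cₛ^∞⟮𝓡 n; F, E⟯) (x : M) :
    𝓔.bracket a b x + 𝓔.bracket b a x
      = 𝓔.ι x (mvfderiv (𝓡 n) (fun y => 𝓔.pairing y (a y) (b y)) x).toLinearMap := by
  have h := 𝓔.bracket_self (a + b) x
  have hd : (mvfderiv (𝓡 n) (fun y => 𝓔.pairing y ((a + b) y) ((a + b) y)) x).toLinearMap
      = (mvfderiv (𝓡 n) (fun y => 𝓔.pairing y (a y) (a y)) x).toLinearMap
        + (2 : ℝ) • (mvfderiv (𝓡 n) (fun y => 𝓔.pairing y (a y) (b y)) x).toLinearMap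
        + (mvfderiv (𝓡 n) (fun y => 𝓔.pairing y (b y) (b y)) x).toLinearMap := by
    have h1 : (fun y => 𝓔.pairing y ((a + b) y) ((a + b) y))
        = fun y => ((𝓔.pairing y (a y) (a y) + 𝓔.pairing y (a y) (b y))
          + (𝓔.pairing y (a y) (b y) + 𝓔.pairing y (b y) (b y))) := by
      funext y
      simp only [ContMDiffSection.coe_add, Pi.add_apply, map_add, LinearMap.add_apply,
        𝓔.pairing_symm y (b y) (a y)]
    have paa := 𝓔.pairing_smooth a a
    have pab := 𝓔.pairing_smooth a b
    have pbb := 𝓔.pairing_smooth b b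
    ext v
    rw [h1]
    refine (mvfderiv_add_apply (paa.add pab) (pab.add pbb) x v).trans
      ((congrArg₂ (· + ·) (mvfderiv_add_apply paa pab x v)
        (mvfderiv_add_apply pab pbb x v)).trans ?_)
    simp
    ring
  rw [hd, map_add (𝓔.ι x), map_add (𝓔.ι x), map_smul (𝓔.ι x), smul_add, smul_add, ← 𝓔.bracket_self a x,
    ← 𝓔.bracket_self b x, smul_smul] at h
  simp only [map_add, LinearMap.add_apply, ContMDiffSection.coe_add, Pi.add_apply] at h
  norm_num at h
  have h2 := sub_eq_zero.2 h
  rw [← sub_eq_zero, ← h2]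
  abel

/-- The bracket at a point is unchanged by cutoff functions equal to `1` near that point. -/
theorem bracket_cutoff {f : C^∞⟮𝓡 n, M; 𝓘(ℝ, ℝ), ℝ⟯} {x : M} (hf : ∀ᶠ y in nhds x, f y = 1)
    (a b : Cₛ^∞⟮𝓡 n; F, E⟯) :
    𝓔.bracket (smulSection f a) (smulSection f b) x = 𝓔.bracket a b x := by
  have hd : mvfderiv (𝓡 n) f x = 0 := by
    have h1 : (f : M → ℝ) =ᶠ[nhds x] fun _ => (1 : ℝ) := hf
    have h2 : mvfderiv (𝓡 n) f x = mvfderiv (𝓡 n) (fun _ : M => (1 : ℝ)) x := by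
      simp only [mvfderiv]
      have := h1.mfderiv_eq (I := 𝓡 n) (I' := 𝓘(ℝ, ℝ))
      ext v
      exact congrArg (fun L => L v) this
    rw [h2, mvfderiv_const]
  have hfx := hf.self_of_nhds
  have hr : ∀ c d : Cₛ^∞⟮𝓡 n; F, E⟯, 𝓔.bracket c (smulSection f d) x = 𝓔.bracket c d x := by
    intro c d
    rw [𝓔.bracket_leibniz, hd, hfx]
    simp
  have hp : mvfderiv (𝓡 n) (fun y => 𝓔.pairing y (smulSection f a y) (b y)) x
      = mvfderiv (𝓡 n) (fun y => 𝓔.pairing y (a y) (b y)) x := by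
    have h1 : (fun y => 𝓔.pairing y (smulSection f a y) (b y))
        =ᶠ[nhds x] fun y => 𝓔.pairing y (a y) (b y) := by
      filter_upwards [hf] with y hy
      change 𝓔.pairing y (f y • a y) (b y) = _
      rw [hy, one_smul]
    simp only [mvfderiv]
    have := h1.mfderiv_eq (I := 𝓡 n) (I' := 𝓘(ℝ, ℝ))
    ext v
    exact congrArg (fun L => L v) this
  -- The Leibniz axiom concerns the second argument only. The first is reached by swapping, since
  -- the exact term depends only on the germ of the pairing.
  have h3 := 𝓔.bracket_add_swap (smulSection f a) b x
  rw [hp, ← 𝓔.bracket_add_swap a b x, hr] at h3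
  rw [hr]
  exact add_right_cancel h3

theorem pairingC_symm (x : M) (v w : Cx (E x)) : 𝓔.pairingC x v w = 𝓔.pairingC x w v := by
  apply Complex.ext <;> simp [pairingC, 𝓔.pairing_symm x v.re, 𝓔.pairing_symm x v.im]
  ring

theorem pairingC_ι (x : M) (ξ : TangentSpace (𝓡 n) x →ₗ[ℝ] ℂ) (v : Cx (E x)) :
    𝓔.pairingC x (Cx.mapDual (𝓔.ι x) ξ) v = Cx.eval ξ (Cx.map (𝓔.anchor x) v) := by
  apply Complex.ext <;> simp [pairingC, 𝓔.pairing_ι]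
  ring

theorem map_anchor_ι (x : M) (ξ : TangentSpace (𝓡 n) x →ₗ[ℝ] ℂ) :
    Cx.map (𝓔.anchor x) (Cx.mapDual (𝓔.ι x) ξ) = 0 := by
  ext1 <;> simp [(𝓔.exact x).apply_apply_eq_zero]

theorem contMDiff_pairingC (a b : Cx (Cₛ^∞⟮𝓡 n; F, E⟯)) :
    ContMDiff (𝓡 n) 𝓘(ℝ, ℂ) ∞ (fun y => 𝓔.pairingC y (csec a y) (csec b y)) :=
  contMDiff_complex_iff.2
    ⟨(𝓔.pairing_smooth a.re b.re).sub (𝓔.pairing_smooth a.im b.im),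
      (𝓔.pairing_smooth a.re b.im).add (𝓔.pairing_smooth a.im b.re)⟩

theorem bracketC_add_left (a a' b : Cx (Cₛ^∞⟮𝓡 n; F, E⟯)) :
    𝓔.bracketC (a + a') b = 𝓔.bracketC a b + 𝓔.bracketC a' b := by
  ext1 <;> simp [bracketC] <;> abel

theorem bracketC_add_right (a b b' : Cx (Cₛ^∞⟮𝓡 n; F, E⟯)) :
    𝓔.bracketC a (b + b') = 𝓔.bracketC a b + 𝓔.bracketC a b' := by
  ext1 <;> simp [bracketC] <;> abel

theorem bracketC_conj (a b : Cx (Cₛ^∞⟮𝓡 n; F, E⟯)) :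
    𝓔.bracketC (Cx.conj a) (Cx.conj b) = Cx.conj (𝓔.bracketC a b) := by
  ext1 <;> simp [bracketC]
  abel

theorem anchor_bracketC (a b : Cx (Cₛ^∞⟮𝓡 n; F, E⟯)) (x : M) :
    Cx.map (𝓔.anchor x) (csec (𝓔.bracketC a b) x)
      = cLie (fun y => Cx.map (𝓔.anchor y) (csec a y)) (fun y => Cx.map (𝓔.anchor y) (csec b y)) x := by
  ext1
  · simp [bracketC, cLie, 𝓔.anchor_bracket]
  · simp [bracketC, cLie, 𝓔.anchor_bracket]

theorem dirDeriv_pairingC (a b c : Cx (Cₛ^∞⟮𝓡 n; F, E⟯)) (x : M) :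
    dirDeriv (fun y => Cx.map (𝓔.anchor y) (csec a y))
        (fun y => 𝓔.pairingC y (csec b y) (csec c y)) x
      = 𝓔.pairingC x (csec (𝓔.bracketC a b) x) (csec c x)
        + 𝓔.pairingC x (csec b x) (csec (𝓔.bracketC a c) x) := by
  have p := fun e e' => 𝓔.pairing_smooth e e'
  apply Complex.ext
  · rw [dirDeriv_re (𝓔.contMDiff_pairingC b c)]
    simp only [pairingC, Cx.bilin_re, Cx.bilin_im, csec_re, csec_im, Cx.map_re, Cx.map_im]
    rw [mvfderiv_sub_apply (p _ _) (p _ _), mvfderiv_add_apply (p _ _) (p _ _)]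
    simp only [𝓔.bracket_pairing, bracketC, Complex.add_re, Cx.bilin_re, csec_re, csec_im,
      ContMDiffSection.coe_add, ContMDiffSection.coe_sub, Pi.add_apply, Pi.sub_apply, map_add,
      map_sub, LinearMap.add_apply, LinearMap.sub_apply]
    ring
  · rw [dirDeriv_im (𝓔.contMDiff_pairingC b c)]
    simp only [pairingC, Cx.bilin_re, Cx.bilin_im, csec_re, csec_im, Cx.map_re, Cx.map_im]
    rw [mvfderiv_sub_apply (p _ _) (p _ _), mvfderiv_add_apply (p _ _) (p _ _)]
    simp only [𝓔.bracket_pairing, bracketC, Complex.add_im, Cx.bilin_im, csec_re, csec_im,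
      ContMDiffSection.coe_add, ContMDiffSection.coe_sub, Pi.add_apply, Pi.sub_apply, map_add,
      map_sub, LinearMap.add_apply, LinearMap.sub_apply]
    ring

theorem csec_bracketC_add_swap (a b : Cx (Cₛ^∞⟮𝓡 n; F, E⟯)) (x : M) :
    csec (𝓔.bracketC a b) x + csec (𝓔.bracketC b a) x
      = Cx.mapDual (𝓔.ι x) (cdiff (fun y => 𝓔.pairingC y (csec a y) (csec b y)) x) := by
  have p := fun e e' => 𝓔.pairing_smooth e e'
  have hf := 𝓔.contMDiff_pairingC a b
  ext1
  · have h : Complex.reLm ∘ₗ cdiff (fun y => 𝓔.pairingC y (csec a y) (csec b y)) x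
        = (mvfderiv (𝓡 n) (fun y => 𝓔.pairing y (a.re y) (b.re y)) x).toLinearMap
          - (mvfderiv (𝓡 n) (fun y => 𝓔.pairing y (a.im y) (b.im y)) x).toLinearMap := by
      ext v
      exact (cdiff_re hf x v).trans (mvfderiv_sub_apply (p _ _) (p _ _) x v)
    rw [Cx.mapDual_re, h, map_sub, ← 𝓔.bracket_add_swap, ← 𝓔.bracket_add_swap]
    simp [bracketC]
    abel
  · have h : Complex.imLm ∘ₗ cdiff (fun y => 𝓔.pairingC y (csec a y) (csec b y)) x
        = (mvfderiv (𝓡 n) (fun y => 𝓔.pairing y (a.re y) (b.im y)) x).toLinearMap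
          + (mvfderiv (𝓡 n) (fun y => 𝓔.pairing y (a.im y) (b.re y)) x).toLinearMap := by
      ext v
      exact (cdiff_im hf x v).trans (mvfderiv_add_apply (p _ _) (p _ _) x v)
    rw [Cx.mapDual_im, h, map_add, ← 𝓔.bracket_add_swap, ← 𝓔.bracket_add_swap]
    simp [bracketC]
    abel

theorem csec_bracketC_cutoff {f : C^∞⟮𝓡 n, M; 𝓘(ℝ, ℝ), ℝ⟯} {x : M}
    (hf : ∀ᶠ y in nhds x, f y = 1) (a b : Cx (Cₛ^∞⟮𝓡 n; F, E⟯)) :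
    csec (𝓔.bracketC ⟨smulSection f a.re, smulSection f a.im⟩
      ⟨smulSection f b.re, smulSection f b.im⟩) x = csec (𝓔.bracketC a b) x := by
  ext1 <;> simp [bracketC, 𝓔.bracket_cutoff hf]

/-- The complex section `ι ξ` for a smooth complex 1-form `ξ`. -/
def ιSec {ξ : ∀ x : M, TangentSpace (𝓡 n) x →ₗ[ℝ] ℂ} (hξ : SmoothCForm ξ) :
    Cx (Cₛ^∞⟮𝓡 n; F, E⟯) :=
  ⟨⟨fun x => 𝓔.ι x (Complex.reLm ∘ₗ ξ x), 𝓔.ι_smooth _ hξ.re⟩,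
    ⟨fun x => 𝓔.ι x (Complex.imLm ∘ₗ ξ x), 𝓔.ι_smooth _ hξ.im⟩⟩

theorem csec_ιSec {ξ : ∀ x : M, TangentSpace (𝓡 n) x →ₗ[ℝ] ℂ} (hξ : SmoothCForm ξ) (x : M) :
    csec (𝓔.ιSec hξ) x = Cx.mapDual (𝓔.ι x) (ξ x) := rfl

/-- `⟨[a, ι ξ], e⟩ = (L_X ξ)(Y)` for sections `a`, `e` over `X`, `Y`. -/
theorem pairingC_bracketC_ι {ξ : ∀ x : M, TangentSpace (𝓡 n) x →ₗ[ℝ] ℂ} (hξ : SmoothCForm ξ)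
    (a e : Cx (Cₛ^∞⟮𝓡 n; F, E⟯)) (x : M) :
    𝓔.pairingC x (csec (𝓔.bracketC a (𝓔.ιSec hξ)) x) (csec e x)
      = lieForm (fun y => Cx.map (𝓔.anchor y) (csec a y)) ξ
          (fun y => Cx.map (𝓔.anchor y) (csec e y)) x := by
  -- Invariance of the pairing, with `⟨ι ξ, ·⟩ = ξ ∘ anchor`, is exactly the defining formula of the
  -- Lie derivative.
  have h := 𝓔.dirDeriv_pairingC a (𝓔.ιSec hξ) e x
  simp only [csec_ιSec, 𝓔.pairingC_ι, 𝓔.anchor_bracketC] at h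
  rw [lieForm, h]
  ring

/-- The bracket on sections `b = a + ι ξ` compared with that on the sections `a`. -/
theorem pairingC_bracketC_add_ι {ξ₁ ξ₂ ξ₃ : ∀ x : M, TangentSpace (𝓡 n) x →ₗ[ℝ] ℂ}
    (h₁ : SmoothCForm ξ₁) (h₂ : SmoothCForm ξ₂) (h₃ : SmoothCForm ξ₃)
    (a₁ a₂ a₃ : Cx (Cₛ^∞⟮𝓡 n; F, E⟯)) {X₁ X₂ X₃ : ∀ x : M, Cx (TangentSpace (𝓡 n) x)}
    (hX₁ : ∀ x, Cx.map (𝓔.anchor x) (csec a₁ x) = X₁ x)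
    (hX₂ : ∀ x, Cx.map (𝓔.anchor x) (csec a₂ x) = X₂ x)
    (hX₃ : ∀ x, Cx.map (𝓔.anchor x) (csec a₃ x) = X₃ x) (x : M) :
    𝓔.pairingC x (csec (𝓔.bracketC (a₁ + 𝓔.ιSec h₁) (a₂ + 𝓔.ιSec h₂)) x)
        (csec (a₃ + 𝓔.ιSec h₃) x)
      = 𝓔.pairingC x (csec (𝓔.bracketC a₁ a₂) x) (csec a₃ x)
        + lieForm X₁ ξ₂ X₃ x - lieForm X₂ ξ₁ X₃ x
        + dirDeriv X₃ (fun y => Cx.eval (ξ₁ y) (X₂ y)) x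
        + Cx.eval (ξ₃ x) (cLie X₁ X₂ x) := by
  obtain rfl := funext hX₁
  obtain rfl := funext hX₂
  obtain rfl := funext hX₃
  have hanchor : ∀ {ξ : ∀ x : M, TangentSpace (𝓡 n) x →ₗ[ℝ] ℂ} (h : SmoothCForm ξ)
      (a : Cx (Cₛ^∞⟮𝓡 n; F, E⟯)), (fun y => Cx.map (𝓔.anchor y) (csec (a + 𝓔.ιSec h) y))
        = fun y => Cx.map (𝓔.anchor y) (csec a y) := by
    intro ξ h a
    funext y
    rw [csec_add, map_add, csec_ιSec, 𝓔.map_anchor_ι, add_zero]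
  -- A form in the first argument is moved to the second by the swap formula, at the cost of the
  -- exact term `ι d⟨ι ξ₁, a₂⟩`. Terms containing two forms drop out because `ι` lands in the kernel
  -- of the anchor.
  have hz : 𝓔.pairingC x (csec (𝓔.bracketC (𝓔.ιSec h₁) (a₂ + 𝓔.ιSec h₂)) x)
      (csec (a₃ + 𝓔.ιSec h₃) x)
      = - lieForm (fun y => Cx.map (𝓔.anchor y) (csec a₂ y)) ξ₁
          (fun y => Cx.map (𝓔.anchor y) (csec a₃ y)) x
        + dirDeriv (fun y => Cx.map (𝓔.anchor y) (csec a₃ y))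
          (fun y => Cx.eval (ξ₁ y) (Cx.map (𝓔.anchor y) (csec a₂ y))) x := by
    have h := congrArg (fun v => 𝓔.pairingC x v (csec (a₃ + 𝓔.ιSec h₃) x))
      (𝓔.csec_bracketC_add_swap (𝓔.ιSec h₁) (a₂ + 𝓔.ιSec h₂) x)
    simp only [map_add, LinearMap.add_apply, 𝓔.pairingC_bracketC_ι, hanchor, csec_ιSec,
      𝓔.pairingC_ι] at h
    have h' := congrFun (hanchor h₂ a₂)
    have h'' := congrFun (hanchor h₃ a₃) x
    simp only [h', h''] at h
    rw [dirDeriv, ← h]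
    ring
  rw [𝓔.bracketC_add_left, 𝓔.bracketC_add_right, csec_add, csec_add]
  simp only [map_add, LinearMap.add_apply]
  rw [hz, 𝓔.pairingC_bracketC_ι, hanchor, csec_add, map_add, csec_ιSec, 𝓔.pairingC_symm x _
    (Cx.mapDual (𝓔.ι x) (ξ₃ x)), 𝓔.pairingC_ι, 𝓔.anchor_bracketC]
  ring

end ExactCourantAlgebroid
end CourantCalculus

/-- The opposite sign. -/
def Sgn.opp : Sgn → Sgn
  | .plus => .minus
  | .minus => .plus

@[simp] theorem Sgn.val_opp (s : Sgn) : s.opp.val = -s.val := by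
  cases s <;> simp [Sgn.opp, Sgn.val]

namespace Cx

variable {V W : Type*} [AddCommGroup V] [Module ℝ V] [AddCommGroup W] [Module ℝ W]

theorem eq_zero_of_bilin {B : V →ₗ[ℝ] V →ₗ[ℝ] ℝ} (hB : ∀ v, (∀ w, B v w = 0) → v = 0)
    {v : Cx V} (h : ∀ w, bilin B v w = 0) : v = 0 := by
  have h1 : ∀ w, B v.re w = 0 ∧ B v.im w = 0 := by
    intro w
    have h2 := h ⟨w, 0⟩
    exact ⟨by simpa using congrArg Complex.re h2, by simpa using congrArg Complex.im h2⟩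
  ext1
  · exact hB _ fun w => (h1 w).1
  · exact hB _ fun w => (h1 w).2

end Cx

/-! ### The decomposition `E = C_+ ⊕ C_-` and the metric `g`. -/

namespace GeneralizedKahler

variable {n : ℕ} {M : Type*} [TopologicalSpace M] [ChartedSpace (EuclideanSpace ℝ (Fin n)) M]
  [IsManifold (𝓡 n) ∞ M]
  {F : Type*} [NormedAddCommGroup F] [NormedSpace ℝ F]
  {E : M → Type*} [TopologicalSpace (TotalSpace F E)] [∀ x, TopologicalSpace (E x)]
  [∀ x, AddCommGroup (E x)] [∀ x, Module ℝ (E x)] [FiberBundle F E] [VectorBundle ℝ F E]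
  {𝓔 : ExactCourantAlgebroid n F E} (K : GeneralizedKahler 𝓔)

theorem split_mem (s : Sgn) (x : M) (v : TangentSpace (𝓡 n) x) : K.split s x v ∈ K.C s x :=
  Submodule.coe_mem _

@[simp] theorem anchor_split (s : Sgn) (x : M) (v : TangentSpace (𝓡 n) x) :
    𝓔.anchor x (K.split s x v) = v :=
  LinearEquiv.apply_symm_apply (LinearEquiv.ofBijective _ (K.anchor_C_bijective s x)) v

theorem Jm_eq_of_mem {s : Sgn} {x : M} {e : E x} (he : e ∈ K.C s x) :
    K.Jm x e = s.val • K.Jp x e := by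
  have h := congrArg (K.Jp x) (K.mem_C.1 he)
  rw [K.isGC_p.sq, map_neg, map_smul, neg_inj] at h
  exact h

theorem Jp_mem_C {s : Sgn} {x : M} {e : E x} (he : e ∈ K.C s x) : K.Jp x e ∈ K.C s x := by
  rw [K.mem_C, ← K.comm, K.mem_C.1 he]
  simp

theorem Jp_split (s : Sgn) (x : M) (v : TangentSpace (𝓡 n) x) :
    K.Jp x (K.split s x v) = K.split s x (K.I s x v) :=
  (K.split_anchor (K.Jp_mem_C (K.split_mem s x v))).symm

theorem Jm_split (s : Sgn) (x : M) (v : TangentSpace (𝓡 n) x) :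
    K.Jm x (K.split s x v) = s.val • K.split s x (K.I s x v) := by
  rw [K.Jm_eq_of_mem (K.split_mem s x v), K.Jp_split]

theorem I_sq (s : Sgn) (x : M) (v : TangentSpace (𝓡 n) x) : K.I s x (K.I s x v) = -v := by
  have h := congrArg (𝓔.anchor x) (K.isGC_p.sq x (K.split s x v))
  rwa [K.Jp_split, K.Jp_split, K.anchor_split, map_neg, K.anchor_split] at h

/-- The projection of `E` onto `C_±`. -/
def projC (s : Sgn) (x : M) : E x →ₗ[ℝ] E x :=
  (1 / 2 : ℝ) • (LinearMap.id - s.val • K.Jp x ∘ₗ K.Jm x)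

theorem projC_mem (s : Sgn) (x : M) (e : E x) : K.projC s x e ∈ K.C s x := by
  rw [K.mem_C]
  simp only [projC, LinearMap.smul_apply, LinearMap.sub_apply, LinearMap.id_apply,
    LinearMap.comp_apply, map_smul, map_sub, K.metric_sq]
  cases s <;> simp only [Sgn.val] <;> module

theorem projC_of_mem {s : Sgn} {x : M} {e : E x} (he : e ∈ K.C s x) : K.projC s x e = e := by
  simp only [projC, LinearMap.smul_apply, LinearMap.sub_apply, LinearMap.id_apply,
    LinearMap.comp_apply, K.mem_C.1 he, smul_neg, smul_smul, s.val_mul_val]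
  module

theorem projC_add_opp (s : Sgn) (x : M) (e : E x) :
    K.projC s x e + K.projC s.opp x e = e := by
  simp only [projC, LinearMap.smul_apply, LinearMap.sub_apply, LinearMap.id_apply,
    LinearMap.comp_apply, Sgn.val_opp]
  module

theorem pairing_split_opp (s : Sgn) (x : M) (v w : TangentSpace (𝓡 n) x) :
    𝓔.pairing x (K.split s x v) (K.split s.opp x w) = 0 := by
  refine K.pairing_C_orthogonal (K.split_mem s x v) ?_
  rw [K.mem_C.1 (K.split_mem s.opp x w), Sgn.val_opp, neg_smul, neg_neg]

/-- The inverse of the Riemannian metric, as a map `T^* → T`. -/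
def ginv (x : M) : (TangentSpace (𝓡 n) x →ₗ[ℝ] ℝ) →ₗ[ℝ] TangentSpace (𝓡 n) x :=
  𝓔.anchor x ∘ₗ K.projC .plus x ∘ₗ 𝓔.ι x

/-- The component of `ι ξ` in `C_+` is a lift of `g⁻¹ ξ` by the choice of `ginv`. As `ι ξ` has zero
anchor, the component in `C_-` must lift `-g⁻¹ ξ`. -/
theorem ι_eq (x : M) (ξ : TangentSpace (𝓡 n) x →ₗ[ℝ] ℝ) :
    𝓔.ι x ξ = K.split .plus x (K.ginv x ξ) - K.split .minus x (K.ginv x ξ) := by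
  have h1 := K.projC_add_opp .plus x (𝓔.ι x ξ)
  have h2 : K.split .plus x (K.ginv x ξ) = K.projC .plus x (𝓔.ι x ξ) :=
    K.split_anchor (K.projC_mem _ _ _)
  have h3 : K.split .minus x (𝓔.anchor x (K.projC .minus x (𝓔.ι x ξ)))
      = K.projC .minus x (𝓔.ι x ξ) := K.split_anchor (K.projC_mem _ _ _)
  have h4 : 𝓔.anchor x (K.projC .minus x (𝓔.ι x ξ)) = -K.ginv x ξ := by
    have h5 := congrArg (𝓔.anchor x) h1
    rw [map_add, (𝓔.exact x).apply_apply_eq_zero] at h5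
    exact eq_neg_of_add_eq_zero_right h5
  rw [h4, map_neg] at h3
  rw [sub_eq_add_neg, h2, h3]
  exact h1.symm

theorem ι_eq_smul (s : Sgn) (x : M) (ξ : TangentSpace (𝓡 n) x →ₗ[ℝ] ℝ) :
    𝓔.ι x ξ = s.val • (K.split s x (K.ginv x ξ) - K.split s.opp x (K.ginv x ξ)) := by
  rw [K.ι_eq]
  cases s <;> simp [Sgn.val, Sgn.opp]

/-- This justifies the name `ginv`: pairing `ι ξ` with a vector of `C_+` sees only the `C_+`
component. -/
theorem g_ginv (x : M) (ξ : TangentSpace (𝓡 n) x →ₗ[ℝ] ℝ) (v : TangentSpace (𝓡 n) x) :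
    K.g x (K.ginv x ξ) v = ξ v := by
  have h := 𝓔.pairing_ι x ξ (K.split .plus x v)
  have h2 := K.pairing_split_opp .minus x (K.ginv x ξ) v
  rw [K.ι_eq, K.anchor_split, map_sub, LinearMap.sub_apply] at h
  rw [← h]
  change _ = _ - 𝓔.pairing x (K.split .minus x (K.ginv x ξ)) (K.split Sgn.minus.opp x v)
  rw [h2, sub_zero]
  rfl

theorem g_symm (x : M) (v w : TangentSpace (𝓡 n) x) : K.g x v w = K.g x w v :=
  𝓔.pairing_symm x _ _

theorem g_pos {x : M} {v : TangentSpace (𝓡 n) x} (hv : v ≠ 0) : 0 < K.g x v v := by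
  have h := K.pos x (K.split .plus x v) (fun h => hv (by
    rw [← K.anchor_split .plus x v, h, map_zero]))
  rw [K.pairing_metric (K.split_mem .plus x v)] at h
  rwa [Sgn.val, one_mul] at h

theorem eq_zero_of_g {x : M} {v : TangentSpace (𝓡 n) x} (h : ∀ w, K.g x v w = 0) : v = 0 := by
  by_contra hv
  exact (K.g_pos hv).ne' (h v)

theorem pairing_split (s : Sgn) (x : M) (v w : TangentSpace (𝓡 n) x) :
    𝓔.pairing x (K.split s x v) (K.split s x w) = s.val * K.g x v w := by
  cases s with
  | plus => simp [Sgn.val, g]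
  | minus =>
    -- The difference `s_+ v - s_- v` is some `ι ξ`, whose pairings with `s_+ w` and `s_- w` both
    -- equal `ξ w`. Orthogonality of `C_+` and `C_-` turns this into `⟨s_+ v, s_+ w⟩ = -⟨s_- v, s_-
    -- w⟩`.
    have h0 : 𝓔.anchor x (K.split .plus x v - K.split .minus x v) = 0 := by simp
    obtain ⟨ξ, hξ⟩ := (𝓔.exact x _).1 h0
    have h1 := 𝓔.pairing_ι x ξ (K.split .plus x w)
    have h2 := 𝓔.pairing_ι x ξ (K.split .minus x w)
    have h3 : 𝓔.pairing x (K.split .minus x v) (K.split .plus x w) = 0 :=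
      K.pairing_split_opp .minus x v w
    have h4 : 𝓔.pairing x (K.split .plus x v) (K.split .minus x w) = 0 :=
      K.pairing_split_opp .plus x v w
    rw [hξ, map_sub, LinearMap.sub_apply, K.anchor_split, h3] at h1
    rw [hξ, map_sub, LinearMap.sub_apply, K.anchor_split, h4] at h2
    change _ = -1 * 𝓔.pairing x (K.split .plus x v) (K.split .plus x w)
    linarith

theorem g_I_I (s : Sgn) (x : M) (v w : TangentSpace (𝓡 n) x) :
    K.g x (K.I s x v) (K.I s x w) = K.g x v w := by
  have h := K.isGC_p.orthogonal x (K.split s x v) (K.split s x w)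
  rw [K.Jp_split, K.Jp_split, K.pairing_split, K.pairing_split] at h
  have h2 := s.val_mul_val
  have h3 := congrArg (s.val * ·) h
  simp only [← mul_assoc, h2, one_mul] at h3
  exact h3

theorem g_I_left (s : Sgn) (x : M) (v w : TangentSpace (𝓡 n) x) :
    K.g x (K.I s x v) w = -K.g x v (K.I s x w) := by
  rw [← K.g_I_I s x (K.I s x v) w, K.I_sq, map_neg, LinearMap.neg_apply]

theorem ginv_eq_of {x : M} {ξ : TangentSpace (𝓡 n) x →ₗ[ℝ] ℝ} {v : TangentSpace (𝓡 n) x}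
    (h : ∀ w, K.g x v w = ξ w) : K.ginv x ξ = v := by
  refine sub_eq_zero.1 (K.eq_zero_of_g fun w => ?_)
  rw [map_sub, LinearMap.sub_apply, K.g_ginv, h, sub_self]

theorem ginv_comp_I (s : Sgn) (x : M) (ξ : TangentSpace (𝓡 n) x →ₗ[ℝ] ℝ) :
    K.ginv x (ξ ∘ₗ K.I s x) = -K.I s x (K.ginv x ξ) := by
  refine K.ginv_eq_of fun w => ?_
  rw [map_neg, LinearMap.neg_apply, K.g_I_left, neg_neg, K.g_ginv]
  rfl

/-! ### Smoothness -/

/-- The section `J₊ e`. -/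
def JpSec (e : Cₛ^∞⟮𝓡 n; F, E⟯) : Cₛ^∞⟮𝓡 n; F, E⟯ := ⟨fun x => K.Jp x (e x), K.isGC_p.smooth e⟩

/-- The section `J₋ e`. -/
def JmSec (e : Cₛ^∞⟮𝓡 n; F, E⟯) : Cₛ^∞⟮𝓡 n; F, E⟯ := ⟨fun x => K.Jm x (e x), K.isGC_m.smooth e⟩

/-- The component in `C_±` of a section. -/
def projCSec (s : Sgn) (e : Cₛ^∞⟮𝓡 n; F, E⟯) : Cₛ^∞⟮𝓡 n; F, E⟯ :=
  (1 / 2 : ℝ) • (e - s.val • K.JpSec (K.JmSec e))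

theorem projCSec_apply (s : Sgn) (e : Cₛ^∞⟮𝓡 n; F, E⟯) (x : M) :
    K.projCSec s e x = K.projC s x (e x) := rfl

theorem smoothVF_ginv {ξ : ∀ x : M, TangentSpace (𝓡 n) x →ₗ[ℝ] ℝ} (hξ : SmoothForm ξ) :
    SmoothVF (fun x => K.ginv x (ξ x)) :=
  𝓔.anchor_smooth (K.projCSec .plus ⟨_, 𝓔.ι_smooth ξ hξ⟩)

variable [T2Space M] [ContMDiffVectorBundle ∞ F E (𝓡 n)]

/-- Fibrewise inversion of the anchor gives no smoothness by itself. Projecting smooth sections to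
`C_s` yields elements of `C_s` whose anchors frame the tangent bundle near `x₀`. Expanding `X` in
this frame expresses `s_s X` through those sections with the same smooth coefficients. -/
theorem contMDiff_split (s : Sgn) {X : ∀ x : M, TangentSpace (𝓡 n) x} (hX : SmoothVF X) :
    ContMDiff (𝓡 n) ((𝓡 n).prod 𝓘(ℝ, F)) ∞
      (fun x => TotalSpace.mk' F x (K.split s x (X x))) := by
  intro x₀
  set t := trivializationAt (EuclideanSpace ℝ (Fin n)) (TangentSpace (𝓡 n) : M → Type _) x₀
  have ht := FiberBundle.mem_baseSet_trivializationAt' (F := EuclideanSpace ℝ (Fin n))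
    (E := (TangentSpace (𝓡 n) : M → Type _)) x₀
  choose c hc using fun i : Fin n => exists_section_eq (n := n) (F := F) x₀
    (K.split s x₀ (t.symm x₀ (EuclideanSpace.single i (1 : ℝ))))
  have hcw : ∀ i x, K.split s x (𝓔.anchor x (K.projCSec s (c i) x)) = K.projCSec s (c i) x :=
    fun i x => K.split_anchor (K.projC_mem s x (c i x))
  obtain ⟨f, hf, hX'⟩ := exists_local_coeff (w := fun i x => 𝓔.anchor x (K.projCSec s (c i) x))
    (x₀ := x₀) (fun i => 𝓔.anchor_smooth _) (by
      intro i
      rw [projCSec_apply, hc, K.projC_of_mem (K.split_mem _ _ _), K.anchor_split]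
      exact (Prod.ext_iff.1 (t.apply_mk_symm ht (EuclideanSpace.single i (1 : ℝ)))).2) hX
  have h : ContMDiffAt (𝓡 n) ((𝓡 n).prod 𝓘(ℝ, F)) ∞
      (fun x => TotalSpace.mk' F x (∑ i, f i x • K.projCSec s (c i) x)) x₀ :=
    ContMDiffAt.sum_section fun i _ =>
      ContMDiffAt.smul_section (hf i) ((K.projCSec s (c i)).contMDiff x₀)
  refine h.congr_of_eventuallyEq ?_
  filter_upwards [hX'] with y hy
  rw [hy, map_sum]
  simp only [map_smul, hcw]

/-- The section `s_± X`. -/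
def splitSec (s : Sgn) {X : ∀ x : M, TangentSpace (𝓡 n) x} (hX : SmoothVF X) :
    Cₛ^∞⟮𝓡 n; F, E⟯ := ⟨fun x => K.split s x (X x), K.contMDiff_split s hX⟩

theorem smoothVF_I (s : Sgn) {X : ∀ x : M, TangentSpace (𝓡 n) x} (hX : SmoothVF X) :
    SmoothVF (fun x => K.I s x (X x)) :=
  𝓔.anchor_smooth (K.JpSec (K.splitSec s hX))

theorem smoothCVF_I (s : Sgn) {V : ∀ x : M, Cx (TangentSpace (𝓡 n) x)} (hV : SmoothCVF V) :
    SmoothCVF (fun x => Cx.map (K.I s x) (V x)) :=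
  ⟨K.smoothVF_I s hV.1, K.smoothVF_I s hV.2⟩

/-- The complex section `s_± V`. -/
def splitCSec (s : Sgn) {V : ∀ x : M, Cx (TangentSpace (𝓡 n) x)} (hV : SmoothCVF V) :
    Cx (Cₛ^∞⟮𝓡 n; F, E⟯) := ⟨K.splitSec s hV.1, K.splitSec s hV.2⟩

theorem csec_splitCSec (s : Sgn) {V : ∀ x : M, Cx (TangentSpace (𝓡 n) x)} (hV : SmoothCVF V)
    (x : M) : csec (K.splitCSec s hV) x = Cx.map (K.split s x) (V x) := rfl

end GeneralizedKahler

/-! ### Reduction of a subspace lying between `D` and `D^⊥`. -/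

section Reduction

variable {W : Type*} [AddCommGroup W] [Module ℂ W] {B : W →ₗ[ℂ] W →ₗ[ℂ] ℂ} {D L : Submodule ℂ W}

/-- For `D ≤ L ≤ D^⊥` the subspace `L ∩ D^⊥ + D` is `L`, so membership in the reduction can be
tested on any representative. -/
theorem mkQ_mem_redSub (hD : D ≤ L) (hL : L ≤ perp B D) (v : perp B D) :
    (D.submoduleOf (perp B D)).mkQ v ∈ redSub B D L ↔ v.1 ∈ L := by
  have h1 : L ⊓ perp B D ⊔ D = L := by rw [inf_eq_left.2 hL, sup_eq_left.2 hD]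
  rw [redSub, h1, ← Submodule.mem_comap, Submodule.comap_map_mkQ, sup_eq_right.2]
  · rfl
  · exact Submodule.comap_mono hD

theorem mem_redPre_redSub (hD : D ≤ L) (hL : L ≤ perp B D) {v : W} :
    v ∈ redPre B D (redSub B D L) ↔ v ∈ L := by
  constructor
  · rintro ⟨w, hw, rfl⟩
    exact (mkQ_mem_redSub hD hL w).1 hw
  · intro hv
    exact ⟨⟨v, hL hv⟩, (mkQ_mem_redSub hD hL _).2 hv, rfl⟩

end Reduction

/-! ### Eigenbundles as Dirac structures, integrability of `I_±`, and transversality. -/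

section Dirac

variable {n : ℕ} {M : Type*} [TopologicalSpace M] [ChartedSpace (EuclideanSpace ℝ (Fin n)) M]
  [IsManifold (𝓡 n) ∞ M]
  {F : Type*} [NormedAddCommGroup F] [NormedSpace ℝ F]
  {E : M → Type*} [TopologicalSpace (TotalSpace F E)] [∀ x, TopologicalSpace (E x)]
  [∀ x, AddCommGroup (E x)] [∀ x, Module ℝ (E x)] [FiberBundle F E] [VectorBundle ℝ F E]
  {𝓔 : ExactCourantAlgebroid n F E}

theorem pairingC_nondegenerate (𝓔 : ExactCourantAlgebroid n F E) {x : M} {v : Cx (E x)}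
    (h : ∀ w, 𝓔.pairingC x v w = 0) : v = 0 :=
  Cx.eq_zero_of_bilin (𝓔.pairing_nondegenerate x) h

theorem mul_self_eq_neg_one {c : ℂ} (hc : c = Complex.I ∨ c = -Complex.I) : c * c = -1 := by
  rcases hc with rfl | rfl <;> simp

namespace ExactCourantAlgebroid.IsGeneralizedComplex

variable {J : ∀ x : M, E x →ₗ[ℝ] E x} (hJ : 𝓔.IsGeneralizedComplex J)
include hJ

theorem map_map (x : M) (v : Cx (E x)) : Cx.map (J x) (Cx.map (J x) v) = -v := by
  ext1 <;> simp [hJ.sq]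

theorem pairing_left (x : M) (v w : E x) : 𝓔.pairing x (J x v) w = -𝓔.pairing x v (J x w) := by
  rw [← hJ.orthogonal x (J x v) w, hJ.sq, map_neg, LinearMap.neg_apply]

theorem pairingC_left (x : M) (v w : Cx (E x)) :
    𝓔.pairingC x (Cx.map (J x) v) w = -𝓔.pairingC x v (Cx.map (J x) w) := by
  apply Complex.ext <;> simp [pairingC, hJ.pairing_left] <;> ring

theorem isotropic {c : ℂ} (hc : c = Complex.I ∨ c = -Complex.I) {x : M} {v w : Cx (E x)}
    (hv : v ∈ Cx.eig (J x) c) (hw : w ∈ Cx.eig (J x) c) : 𝓔.pairingC x v w = 0 := by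
  have h := hJ.pairingC_left x v w
  rw [Cx.mem_eig.1 hv, Cx.mem_eig.1 hw, map_smul, map_smul, LinearMap.smul_apply,
    smul_eq_mul] at h
  have h2 : c ≠ 0 := by rcases hc with rfl | rfl <;> simp
  have h3 : (2 * c) * 𝓔.pairingC x v w = 0 := by linear_combination h
  exact (mul_eq_zero.1 h3).resolve_left (by simpa using h2)

theorem sub_smul_mem_eig {c : ℂ} (hc : c = Complex.I ∨ c = -Complex.I) (x : M) (v : Cx (E x)) :
    v - c • Cx.map (J x) v ∈ Cx.eig (J x) c := by
  rw [Cx.mem_eig, map_sub, map_smul, hJ.map_map, smul_sub, smul_smul, mul_self_eq_neg_one hc]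
  module

/-- Maximality of the isotropic eigenspace. Since `w - c J w` always lies in it, skewness of `J`
makes `v + c J v` orthogonal to every `w`, hence zero, which says `J v = c v`. -/
theorem mem_eig_of_orthogonal {c : ℂ} (hc : c = Complex.I ∨ c = -Complex.I) {x : M}
    {v : Cx (E x)} (h : ∀ w ∈ Cx.eig (J x) c, 𝓔.pairingC x v w = 0) : v ∈ Cx.eig (J x) c := by
  have h1 : v + c • Cx.map (J x) v = 0 := by
    refine pairingC_nondegenerate 𝓔 fun w => ?_
    have h2 := h _ (hJ.sub_smul_mem_eig hc x w)
    rw [map_sub, map_smul] at h2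
    rw [map_add, map_smul, LinearMap.add_apply, LinearMap.smul_apply, hJ.pairingC_left]
    simp only [smul_eq_mul] at h2 ⊢
    linear_combination h2
  rw [Cx.mem_eig]
  have h2 := congrArg (c • ·) h1
  simp only [smul_add, smul_smul, mul_self_eq_neg_one hc, smul_zero] at h2
  linear_combination (norm := module) (-1 : ℂ) • h2

/-- The `+i` case is the axiom; the `-i` case follows by conjugation because the bracket is real. -/
theorem bracketC_mem_eig {c : ℂ} (hc : c = Complex.I ∨ c = -Complex.I)
    {a b : Cx (Cₛ^∞⟮𝓡 n; F, E⟯)} (ha : ∀ x, csec a x ∈ Cx.eig (J x) c)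
    (hb : ∀ x, csec b x ∈ Cx.eig (J x) c) (x : M) :
    csec (𝓔.bracketC a b) x ∈ Cx.eig (J x) c := by
  rcases hc with rfl | rfl
  · exact hJ.involutive a b ha hb x
  · have hI : starRingEnd ℂ (-Complex.I) = Complex.I := by simp
    have ha' : ∀ x, csec (Cx.conj a) x ∈ Cx.eig (J x) Complex.I := fun x => by
      have := Cx.conj_mem_eig.2 (ha x)
      rwa [hI] at this
    have hb' : ∀ x, csec (Cx.conj b) x ∈ Cx.eig (J x) Complex.I := fun x => by
      have := Cx.conj_mem_eig.2 (hb x)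
      rwa [hI] at this
    have h := hJ.involutive _ _ ha' hb' x
    rw [𝓔.bracketC_conj, csec_conj, ← hI] at h
    exact Cx.conj_mem_eig.1 h

/-- Involutivity is assumed for global sections. A cutoff supported in `U` makes the sections
globally eigen, being zero outside `U`, and leaves the bracket at `x` unchanged. -/
theorem bracketC_mem_eig_of_isOpen [T2Space M] {c : ℂ} (hc : c = Complex.I ∨ c = -Complex.I)
    {U : Set M} (hU : IsOpen U)
    {a b : Cx (Cₛ^∞⟮𝓡 n; F, E⟯)} (ha : ∀ x ∈ U, csec a x ∈ Cx.eig (J x) c)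
    (hb : ∀ x ∈ U, csec b x ∈ Cx.eig (J x) c) {x : M} (hx : x ∈ U) :
    csec (𝓔.bracketC a b) x ∈ Cx.eig (J x) c := by
  obtain ⟨f, hf, hfU⟩ := exists_cutoff (n := n) hU hx
  have key : ∀ e : Cx (Cₛ^∞⟮𝓡 n; F, E⟯), (∀ x ∈ U, csec e x ∈ Cx.eig (J x) c) →
      ∀ y, csec (⟨smulSection f e.re, smulSection f e.im⟩ : Cx (Cₛ^∞⟮𝓡 n; F, E⟯)) y
        ∈ Cx.eig (J y) c := by
    intro e he y
    have h1 : csec (⟨smulSection f e.re, smulSection f e.im⟩ : Cx (Cₛ^∞⟮𝓡 n; F, E⟯)) y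
        = (f y : ℂ) • csec e y := by
      ext1 <;> simp [smulSection, -Complex.coe_smul]
    rw [h1]
    by_cases hy : y ∈ U
    · exact Submodule.smul_mem _ _ (he y hy)
    · have h2 : f y = 0 := image_eq_zero_of_notMem_tsupport fun h => hy (hfU h)
      simp [h2]
  have h := hJ.bracketC_mem_eig hc (key a ha) (key b hb) x
  rwa [𝓔.csec_bracketC_cutoff hf] at h

theorem exists_section [T2Space M] [ContMDiffVectorBundle ∞ F E (𝓡 n)] {c : ℂ}
    (hc : c = Complex.I ∨ c = -Complex.I) {x : M} {v : Cx (E x)} (hv : v ∈ Cx.eig (J x) c) :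
    ∃ e : Cx (Cₛ^∞⟮𝓡 n; F, E⟯), (∀ y, csec e y ∈ Cx.eig (J y) c) ∧ csec e x = v := by
  obtain ⟨r, hr⟩ := exists_section_eq (n := n) (F := F) x v.re
  obtain ⟨i, hi⟩ := exists_section_eq (n := n) (F := F) x v.im
  let Js : Cₛ^∞⟮𝓡 n; F, E⟯ → Cₛ^∞⟮𝓡 n; F, E⟯ := fun e => ⟨fun x => J x (e x), hJ.smooth e⟩
  let f : Cx (Cₛ^∞⟮𝓡 n; F, E⟯) := ⟨r, i⟩
  -- The projection `(1 - c J) / 2` onto the eigenbundle is applied to an arbitrary extension; it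
  -- fixes `v` because `c² = -1`.
  let e : Cx (Cₛ^∞⟮𝓡 n; F, E⟯) := (1 / 2 : ℂ) • (f - c • (⟨Js r, Js i⟩ : Cx (Cₛ^∞⟮𝓡 n; F, E⟯)))
  have he : ∀ y, csec e y = (1 / 2 : ℂ) • (csec f y - c • Cx.map (J y) (csec f y)) :=
    fun y => rfl
  refine ⟨e, fun y => ?_, ?_⟩
  · rw [he]
    exact Submodule.smul_mem _ _ (hJ.sub_smul_mem_eig hc y _)
  · have hf : csec f x = v := Cx.ext hr hi
    rw [he, hf, Cx.mem_eig.1 hv, smul_smul, mul_self_eq_neg_one hc]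
    module

theorem eig_le_perp {c : ℂ} (hc : c = Complex.I ∨ c = -Complex.I) {x : M}
    {D : Submodule ℂ (Cx (E x))} (hD : D ≤ Cx.eig (J x) c) :
    Cx.eig (J x) c ≤ perp (𝓔.pairingC x) D :=
  fun _ hv _ hd => hJ.isotropic hc (hD hd) hv

/-- The reduction of an eigenbundle of a generalized complex structure by a subbundle is a
holomorphic Dirac structure. -/
theorem isHolomorphicDirac_redSub [T2Space M] [ContMDiffVectorBundle ∞ F E (𝓡 n)] {c : ℂ}
    (hc : c = Complex.I ∨ c = -Complex.I) {D : ∀ x : M, Submodule ℂ (Cx (E x))}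
    (hD : ∀ x, D x ≤ Cx.eig (J x) c) :
    𝓔.IsHolomorphicDirac D (fun x => redSub (𝓔.pairingC x) (D x) (Cx.eig (J x) c)) := by
  have hm : ∀ x v, v ∈ redPre (𝓔.pairingC x) (D x) (redSub (𝓔.pairingC x) (D x) (Cx.eig (J x) c))
      ↔ v ∈ Cx.eig (J x) c :=
    fun x v => mem_redPre_redSub (hD x) (hJ.eig_le_perp hc (hD x))
  constructor
  · intro x v hv
    simp only [hm] at hv ⊢
    exact hJ.exists_section hc hv
  · intro x v _
    simp only [hm]
    exact ⟨fun h w hw => hJ.isotropic hc h hw, fun h => hJ.mem_eig_of_orthogonal hc h⟩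
  · intro d e hd he x
    simp only [hm] at he ⊢
    exact hJ.bracketC_mem_eig hc (fun y => hD y (hd y)) he x
  · intro U hU a b _ _ ha hb x hx
    simp only [hm] at ha hb ⊢
    exact hJ.bracketC_mem_eig_of_isOpen hc hU ha hb hx

end ExactCourantAlgebroid.IsGeneralizedComplex

namespace GeneralizedKahler

variable (K : GeneralizedKahler 𝓔)

theorem Sgn_val_mul_I (s : Sgn) :
    -((s.val : ℂ) * Complex.I) = Complex.I ∨ -((s.val : ℂ) * Complex.I) = -Complex.I := by
  cases s <;> simp [Sgn.val]

theorem Sgn_val_sq (s : Sgn) : (s.val : ℂ) * s.val = 1 := by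
  exact_mod_cast s.val_mul_val

theorem map_Jp_split (s : Sgn) (x : M) (u : Cx (TangentSpace (𝓡 n) x)) :
    Cx.map (K.Jp x) (Cx.map (K.split s x) u) = Cx.map (K.split s x) (Cx.map (K.I s x) u) := by
  ext1 <;> simp [K.Jp_split]

theorem map_Jm_split (s : Sgn) (x : M) (u : Cx (TangentSpace (𝓡 n) x)) :
    Cx.map (K.Jm x) (Cx.map (K.split s x) u)
      = (s.val : ℂ) • Cx.map (K.split s x) (Cx.map (K.I s x) u) := by
  ext1 <;> simp [K.Jm_split, -Complex.coe_smul]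

theorem map_anchor_split (s : Sgn) (x : M) (u : Cx (TangentSpace (𝓡 n) x)) :
    Cx.map (𝓔.anchor x) (Cx.map (K.split s x) u) = u := by
  ext1 <;> simp

theorem map_I_sq (s : Sgn) (x : M) (u : Cx (TangentSpace (𝓡 n) x)) :
    Cx.map (K.I s x) (Cx.map (K.I s x) u) = -u := by
  ext1 <;> simp [K.I_sq]

theorem split_mem_eig_Jp {s : Sgn} {c : ℂ} {x : M} {u : Cx (TangentSpace (𝓡 n) x)}
    (hu : u ∈ Cx.eig (K.I s x) c) : Cx.map (K.split s x) u ∈ Cx.eig (K.Jp x) c := by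
  rw [Cx.mem_eig, K.map_Jp_split, Cx.mem_eig.1 hu, map_smul]

theorem split_mem_eig_Jm {s : Sgn} {c : ℂ} {x : M} {u : Cx (TangentSpace (𝓡 n) x)}
    (hu : u ∈ Cx.eig (K.I s x) c) : Cx.map (K.split s x) u ∈ Cx.eig (K.Jm x) (s.val * c) := by
  rw [Cx.mem_eig, K.map_Jm_split, Cx.mem_eig.1 hu, map_smul, smul_smul]

theorem split_mem_ellBar {s : Sgn} {x : M} {u : Cx (TangentSpace (𝓡 n) x)}
    (hu : u ∈ Cx.eig (K.I s x) (-Complex.I)) : Cx.map (K.split s x) u ∈ K.ellBar s x := by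
  refine ⟨K.split_mem_eig_Jp hu, ?_⟩
  have := K.split_mem_eig_Jm hu
  rwa [mul_neg] at this

/-- On such a joint eigenvector `-J₊ J₋` acts by `-s c² = s`, so the vector lies in `C_s ⊗ ℂ` and is
recovered from its anchor. -/
theorem map_split_anchor {s : Sgn} {c : ℂ} (hc : c = Complex.I ∨ c = -Complex.I) {x : M}
    {e : Cx (E x)} (h1 : e ∈ Cx.eig (K.Jp x) c) (h2 : e ∈ Cx.eig (K.Jm x) (s.val * c)) :
    Cx.map (K.split s x) (Cx.map (𝓔.anchor x) e) = e := by
  have h3 : Cx.map (K.projC s x) e = e := by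
    have h4 : Cx.map (K.projC s x) e
        = (1 / 2 : ℂ) • (e - (s.val : ℂ) • Cx.map (K.Jp x) (Cx.map (K.Jm x) e)) := by
      ext1 <;> simp [projC, -Complex.coe_smul]
    rw [h4, Cx.mem_eig.1 h2, map_smul, Cx.mem_eig.1 h1, smul_smul, smul_smul,
      show (s.val : ℂ) * (s.val * c) * c = (s.val * s.val) * (c * c) by ring, Sgn_val_sq,
      mul_self_eq_neg_one hc]
    module
  rw [← h3]
  ext1 <;> simp [K.split_anchor (K.projC_mem s x _)]

theorem anchor_mem_eig_I {s : Sgn} {c : ℂ} (hc : c = Complex.I ∨ c = -Complex.I) {x : M}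
    {e : Cx (E x)} (h1 : e ∈ Cx.eig (K.Jp x) c) (h2 : e ∈ Cx.eig (K.Jm x) (s.val * c)) :
    Cx.map (𝓔.anchor x) e ∈ Cx.eig (K.I s x) c := by
  have h3 : Cx.map (K.I s x) (Cx.map (𝓔.anchor x) e) = Cx.map (𝓔.anchor x) (Cx.map (K.Jp x)
      (Cx.map (K.split s x) (Cx.map (𝓔.anchor x) e))) := rfl
  rw [Cx.mem_eig, h3, K.map_split_anchor hc h1 h2, Cx.mem_eig.1 h1, map_smul]

/-- Through `split`, the `+i`-eigenbundle of `I_s` becomes the intersection of two involutive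
eigenbundles, of `J₊` and of `J₋`. The anchor carries its bracket to the Lie bracket. -/
theorem isComplexStructure_I [T2Space M] [ContMDiffVectorBundle ∞ F E (𝓡 n)] (s : Sgn) :
    IsComplexStructure (K.I s) where
  smooth _ hX := K.smoothVF_I s hX
  sq := K.I_sq s
  involutive := by
    intro V W hV hW hVe hWe x
    have hc : Complex.I = Complex.I ∨ Complex.I = -Complex.I := Or.inl rfl
    have hc' : (s.val : ℂ) * Complex.I = Complex.I ∨ (s.val : ℂ) * Complex.I = -Complex.I := by
      cases s <;> simp [Sgn.val]
    have h1 := K.isGC_p.bracketC_mem_eig hc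
      (a := K.splitCSec s hV) (b := K.splitCSec s hW)
      (fun y => K.split_mem_eig_Jp (hVe y)) (fun y => K.split_mem_eig_Jp (hWe y)) x
    have h2 := K.isGC_m.bracketC_mem_eig hc'
      (a := K.splitCSec s hV) (b := K.splitCSec s hW)
      (fun y => K.split_mem_eig_Jm (hVe y)) (fun y => K.split_mem_eig_Jm (hWe y)) x
    have h3 := K.anchor_mem_eig_I hc h1 h2
    rw [𝓔.anchor_bracketC] at h3
    simpa only [csec_splitCSec, K.map_anchor_split] using h3

/-! ### The reductions -/

theorem eig_Jp_le_perp (s : Sgn) (x : M) :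
    Cx.eig (K.Jp x) (-Complex.I) ≤ perp (𝓔.pairingC x) (K.ellBar s x) :=
  K.isGC_p.eig_le_perp (Or.inr rfl) inf_le_left

theorem eig_Jm_le_perp (s : Sgn) (x : M) :
    Cx.eig (K.Jm x) (-(s.val * Complex.I)) ≤ perp (𝓔.pairingC x) (K.ellBar s x) :=
  K.isGC_m.eig_le_perp (Sgn_val_mul_I s) inf_le_right

theorem mkQ_mem_A {s : Sgn} {x : M} (v : perp (𝓔.pairingC x) (K.ellBar s x)) :
    Submodule.mkQ _ v ∈ K.A s x ↔ v.1 ∈ Cx.eig (K.Jp x) (-Complex.I) :=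
  mkQ_mem_redSub inf_le_left (K.eig_Jp_le_perp s x) v

theorem mkQ_mem_B {s : Sgn} {x : M} (v : perp (𝓔.pairingC x) (K.ellBar s x)) :
    Submodule.mkQ _ v ∈ K.B s x ↔ v.1 ∈ Cx.eig (K.Jm x) (-(s.val * Complex.I)) :=
  mkQ_mem_redSub inf_le_right (K.eig_Jm_le_perp s x) v

/-- Of the four joint eigenspaces of `J₊` and `J₋`, the pairing makes `ellBar` dual to the conjugate
one. That one is exactly what orthogonality to `ellBar` excludes, and the other three lie in one of
the two eigenspaces. -/
theorem exists_add_of_mem_perp {s : Sgn} {x : M} {e : Cx (E x)}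
    (he : e ∈ perp (𝓔.pairingC x) (K.ellBar s x)) :
    ∃ a ∈ Cx.eig (K.Jp x) (-Complex.I), ∃ b ∈ Cx.eig (K.Jm x) (-(s.val * Complex.I)),
      a + b = e := by
  set c : ℂ := -(s.val * Complex.I) with hcdef
  have hc : c = Complex.I ∨ c = -Complex.I := Sgn_val_mul_I s
  have hi : -Complex.I = Complex.I ∨ -Complex.I = -Complex.I := Or.inr rfl
  have hcomm : ∀ v : Cx (E x), Cx.map (K.Jp x) (Cx.map (K.Jm x) v)
      = Cx.map (K.Jm x) (Cx.map (K.Jp x) v) := fun v => by ext1 <;> simp [K.comm]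
  -- Up to a factor this is the excluded component of `e`. Skewness of `J₊` and `J₋` moves both
  -- projections onto the test vector `f`, turning it into an element of `ellBar`, which pairs to
  -- zero with `e`.
  have hb : (e + (-Complex.I) • Cx.map (K.Jp x) e)
      + c • Cx.map (K.Jm x) (e + (-Complex.I) • Cx.map (K.Jp x) e) = 0 := by
    refine pairingC_nondegenerate 𝓔 fun f => ?_
    set d := f - (-Complex.I) • Cx.map (K.Jp x) f with hd
    have hd1 : d ∈ Cx.eig (K.Jp x) (-Complex.I) := K.isGC_p.sub_smul_mem_eig hi x f
    have hmem : d - c • Cx.map (K.Jm x) d ∈ K.ellBar s x := by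
      refine ⟨?_, K.isGC_m.sub_smul_mem_eig hc x d⟩
      refine Submodule.sub_mem _ hd1 (Submodule.smul_mem _ _ ?_)
      rw [Cx.mem_eig, hcomm, Cx.mem_eig.1 hd1, map_smul]
    have h1 : 𝓔.pairingC x (d - c • Cx.map (K.Jm x) d) e = 0 := he _ hmem
    rw [hd] at h1
    rw [𝓔.pairingC_symm]
    simp only [map_sub, map_add, map_smul, LinearMap.sub_apply, LinearMap.smul_apply,
      K.isGC_p.pairingC_left, K.isGC_m.pairingC_left, smul_eq_mul] at h1 ⊢
    rw [hcomm] at h1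
    linear_combination h1
  refine ⟨(1 / 2 : ℂ) • (e - (-Complex.I) • Cx.map (K.Jp x) e),
    Submodule.smul_mem _ _ (K.isGC_p.sub_smul_mem_eig hi x e),
    (1 / 2 : ℂ) • (e + (-Complex.I) • Cx.map (K.Jp x) e), Submodule.smul_mem _ _ ?_, by module⟩
  rw [Cx.mem_eig]
  have h2 := congrArg (c • ·) hb
  simp only [smul_add c, smul_smul, mul_self_eq_neg_one hc, smul_zero] at h2
  linear_combination (norm := module) (-1 : ℂ) • h2

theorem isCompl_A_B (s : Sgn) (x : M) : IsCompl (K.A s x) (K.B s x) := by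
  constructor
  · rw [Submodule.disjoint_def]
    intro q ha hb
    obtain ⟨v, rfl⟩ := Submodule.mkQ_surjective _ q
    rw [Submodule.mkQ_apply, Submodule.Quotient.mk_eq_zero]
    exact ⟨(K.mkQ_mem_A v).1 ha, (K.mkQ_mem_B v).1 hb⟩
  · rw [codisjoint_iff, eq_top_iff]
    intro q _
    obtain ⟨v, rfl⟩ := Submodule.mkQ_surjective _ q
    obtain ⟨a, ha, b, hb, hab⟩ := K.exists_add_of_mem_perp v.2
    refine Submodule.mem_sup.2 ⟨Submodule.mkQ _ ⟨a, K.eig_Jp_le_perp s x ha⟩,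
      (K.mkQ_mem_A _).2 ha, Submodule.mkQ _ ⟨b, K.eig_Jm_le_perp s x hb⟩,
      (K.mkQ_mem_B _).2 hb, ?_⟩
    rw [← map_add]
    exact congrArg _ (Subtype.ext hab)

end GeneralizedKahler
end Dirac

/-! ### The explicit bivector, its algebraic symmetries and its type. -/

section Bivector

namespace Cx

variable {V : Type*} [AddCommGroup V] [Module ℝ V]

/-- The `(1,0)`-part of a complex form. -/
def formProj (I : V →ₗ[ℝ] V) (ξ : V →ₗ[ℝ] ℂ) : V →ₗ[ℝ] ℂ :=
  (1 / 2 : ℂ) • (ξ - Complex.I • ξ ∘ₗ I)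

theorem formProj_mem {I : V →ₗ[ℝ] V} (hI : ∀ v, I (I v) = -v) (ξ : V →ₗ[ℝ] ℂ) :
    formProj I ξ ∈ form10 I := by
  intro v
  simp only [formProj, LinearMap.smul_apply, LinearMap.sub_apply, LinearMap.comp_apply, hI,
    map_neg, smul_eq_mul]
  linear_combination (1 / 2 : ℂ) * ξ (I v) * Complex.I_mul_I

theorem eval_formProj {I : V →ₗ[ℝ] V} {ξ : V →ₗ[ℝ] ℂ} {v : Cx V} (hv : v ∈ eig I Complex.I) :
    eval (formProj I ξ) v = eval ξ v := by
  have h1 : eval (formProj I ξ) v = (1 / 2 : ℂ) * (eval ξ v - Complex.I * eval ξ (map I v)) := by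
    simp only [eval, formProj, LinearMap.coe_mk, AddHom.coe_mk, LinearMap.smul_apply,
      LinearMap.sub_apply, LinearMap.comp_apply, smul_eq_mul, map_re, map_im]
    ring
  rw [h1, mem_eig.1 hv, map_smul, smul_eq_mul]
  linear_combination (-1 / 2 : ℂ) * eval ξ v * Complex.I_mul_I

end Cx

variable {n : ℕ} {M : Type*} [TopologicalSpace M] [ChartedSpace (EuclideanSpace ℝ (Fin n)) M]
  [IsManifold (𝓡 n) ∞ M]
  {F : Type*} [NormedAddCommGroup F] [NormedSpace ℝ F]
  {E : M → Type*} [TopologicalSpace (TotalSpace F E)] [∀ x, TopologicalSpace (E x)]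
  [∀ x, AddCommGroup (E x)] [∀ x, Module ℝ (E x)] [FiberBundle F E] [VectorBundle ℝ F E]
  {𝓔 : ExactCourantAlgebroid n F E}

theorem dirDeriv_zero (V : ∀ x : M, Cx (TangentSpace (𝓡 n) x)) (x : M) :
    dirDeriv V (fun _ => (0 : ℂ)) x = 0 := by
  have h : cdiff (n := n) (fun _ : M => (0 : ℂ)) x = 0 := by
    simp only [cdiff, mvfderiv_const]
    rfl
  rw [dirDeriv, h]
  simp [Cx.eval]

theorem dirDeriv_neg (V : ∀ x : M, Cx (TangentSpace (𝓡 n) x)) (f : M → ℂ) (x : M) :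
    dirDeriv V (fun y => -f y) x = -dirDeriv V f x := by
  have h : cdiff (n := n) (fun y => -f y) x = -cdiff f x := by
    have := mvfderiv_neg (I := 𝓡 n) (g := f) (x := x)
    exact congrArg ContinuousLinearMap.toLinearMap this
  rw [dirDeriv, h, dirDeriv]
  simp only [Cx.eval, LinearMap.coe_mk, AddHom.coe_mk, LinearMap.neg_apply]
  ring

namespace GeneralizedKahler

variable (K : GeneralizedKahler 𝓔)

/-- The endomorphism `σ_± g`. -/
def bivec (s : Sgn) (x : M) : Cx (TangentSpace (𝓡 n) x) →ₗ[ℂ] Cx (TangentSpace (𝓡 n) x) :=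
  (s.val / 8 : ℂ) •
    ((Cx.map (K.I s x) ∘ₗ Cx.map (K.I s.opp x) - Cx.map (K.I s.opp x) ∘ₗ Cx.map (K.I s x))
      + Complex.I • (Cx.map (K.I s.opp x)
        + Cx.map (K.I s x) ∘ₗ Cx.map (K.I s.opp x) ∘ₗ Cx.map (K.I s x)))

theorem bivec_apply (s : Sgn) (x : M) (w : Cx (TangentSpace (𝓡 n) x)) :
    K.bivec s x w = (s.val / 8 : ℂ) •
      ((Cx.map (K.I s x) (Cx.map (K.I s.opp x) w) - Cx.map (K.I s.opp x) (Cx.map (K.I s x) w))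
      + Complex.I • (Cx.map (K.I s.opp x) w
        + Cx.map (K.I s x) (Cx.map (K.I s.opp x) (Cx.map (K.I s x) w)))) := rfl

/-- The bivector `σ_±`. -/
def poisson (s : Sgn) (x : M) :
    (TangentSpace (𝓡 n) x →ₗ[ℝ] ℂ) →ₗ[ℂ] Cx (TangentSpace (𝓡 n) x) :=
  K.bivec s x ∘ₗ Cx.mapDual (K.ginv x)

theorem bivec_mem_eig (s : Sgn) (x : M) (w : Cx (TangentSpace (𝓡 n) x)) :
    K.bivec s x w ∈ Cx.eig (K.I s x) Complex.I := by
  rw [Cx.mem_eig, K.bivec_apply]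
  simp only [map_smul, map_add, map_sub, K.map_I_sq]
  linear_combination (norm := module) (-(s.val / 8 : ℂ) * Complex.I_mul_I) •
    (Cx.map (K.I s.opp x) w + Cx.map (K.I s x) (Cx.map (K.I s.opp x) (Cx.map (K.I s x) w)))

theorem eval_eq_bilin_g (x : M) (η : TangentSpace (𝓡 n) x →ₗ[ℝ] ℂ)
    (v : Cx (TangentSpace (𝓡 n) x)) :
    Cx.eval η v = Cx.bilin (K.g x) (Cx.mapDual (K.ginv x) η) v := by
  apply Complex.ext <;> simp [K.g_ginv]
  ring

theorem bilin_g_symm (x : M) (v w : Cx (TangentSpace (𝓡 n) x)) :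
    Cx.bilin (K.g x) v w = Cx.bilin (K.g x) w v := by
  apply Complex.ext <;> simp [K.g_symm x v.re, K.g_symm x v.im]
  ring

theorem bilin_g_I_left (s : Sgn) (x : M) (v w : Cx (TangentSpace (𝓡 n) x)) :
    Cx.bilin (K.g x) (Cx.map (K.I s x) v) w = -Cx.bilin (K.g x) v (Cx.map (K.I s x) w) := by
  apply Complex.ext <;> simp [K.g_I_left] <;> ring

theorem bilin_g_bivec (s : Sgn) (x : M) (v w : Cx (TangentSpace (𝓡 n) x)) :
    Cx.bilin (K.g x) (K.bivec s x v) w = -Cx.bilin (K.g x) v (K.bivec s x w) := by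
  simp only [K.bivec_apply, map_smul, map_add, map_sub, LinearMap.smul_apply,
    LinearMap.add_apply, LinearMap.sub_apply, K.bilin_g_I_left, smul_eq_mul]
  ring

theorem poisson_skew (s : Sgn) (x : M) (ξ η : TangentSpace (𝓡 n) x →ₗ[ℝ] ℂ) :
    Cx.eval η (K.poisson s x ξ) = -Cx.eval ξ (K.poisson s x η) := by
  rw [K.eval_eq_bilin_g, K.eval_eq_bilin_g, K.bilin_g_symm]
  exact K.bilin_g_bivec s x _ _

/-- Consequently `bivec` kills the `+i`-eigenspace of `I_s`, and `poisson` depends only on the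
(1,0)-part of a form. -/
theorem bivec_I (s : Sgn) (x : M) (w : Cx (TangentSpace (𝓡 n) x)) :
    K.bivec s x (Cx.map (K.I s x) w) = (-Complex.I) • K.bivec s x w := by
  rw [K.bivec_apply, K.bivec_apply]
  simp only [map_neg, K.map_I_sq]
  linear_combination (norm := module) ((s.val / 8 : ℂ) * Complex.I_mul_I) •
    (Cx.map (K.I s.opp x) w + Cx.map (K.I s x) (Cx.map (K.I s.opp x) (Cx.map (K.I s x) w)))

theorem mapDual_ginv_comp_I (s : Sgn) (x : M) (ξ : TangentSpace (𝓡 n) x →ₗ[ℝ] ℂ) :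
    Cx.mapDual (K.ginv x) (ξ ∘ₗ K.I s x)
      = -Cx.map (K.I s x) (Cx.mapDual (K.ginv x) ξ) := by
  ext1 <;> simp [← K.ginv_comp_I, LinearMap.comp_assoc]

/-- `I_s` is skew for `g`, so `g⁻¹` exchanges types: (1,0)-forms become (0,1)-vectors. -/
theorem mapDual_ginv_mem_eig {s : Sgn} {x : M} {ξ : TangentSpace (𝓡 n) x →ₗ[ℝ] ℂ}
    (hξ : ξ ∈ Cx.form10 (K.I s x)) :
    Cx.mapDual (K.ginv x) ξ ∈ Cx.eig (K.I s x) (-Complex.I) := by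
  have h1 : ξ ∘ₗ K.I s x = Complex.I • ξ := LinearMap.ext hξ
  have h2 := K.mapDual_ginv_comp_I s x ξ
  rw [h1, map_smul] at h2
  rw [Cx.mem_eig, neg_smul, h2, neg_neg]

theorem poisson_formProj (s : Sgn) (x : M) (ξ : TangentSpace (𝓡 n) x →ₗ[ℝ] ℂ) :
    K.poisson s x (Cx.formProj (K.I s x) ξ) = K.poisson s x ξ := by
  simp only [poisson, LinearMap.comp_apply, Cx.formProj, map_smul, map_sub,
    K.mapDual_ginv_comp_I, map_neg, K.bivec_I]
  linear_combination (norm := module) ((-1 / 2 : ℂ) * Complex.I_mul_I) •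
    K.bivec s x (Cx.mapDual (K.ginv x) ξ)

/-! ### Lifts of `(1,0)`-forms to the eigenbundles -/

/-- The component in `C_∓` of the lift of a `(1,0)`-form `g w`. -/
def liftOpp (s : Sgn) (x : M) (w : Cx (TangentSpace (𝓡 n) x)) : Cx (TangentSpace (𝓡 n) x) :=
  (s.val / 2 : ℂ) • (w + Complex.I • Cx.map (K.I s.opp x) w)

/-- The component in `C_±` of the lift of a `(1,0)`-form `g w`. -/
def liftSame (s : Sgn) (x : M) (w : Cx (TangentSpace (𝓡 n) x)) : Cx (TangentSpace (𝓡 n) x) :=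
  (-1 / 2 : ℂ) • (K.liftOpp s x w + Complex.I • Cx.map (K.I s x) (K.liftOpp s x w))

theorem add_smul_I_mem_eig (s : Sgn) (x : M) (w : Cx (TangentSpace (𝓡 n) x)) :
    w + Complex.I • Cx.map (K.I s x) w ∈ Cx.eig (K.I s x) (-Complex.I) := by
  rw [Cx.mem_eig, map_add, map_smul, K.map_I_sq]
  linear_combination (norm := module) Complex.I_mul_I • Cx.map (K.I s x) w

theorem sub_smul_I_mem_eig (s : Sgn) (x : M) (w : Cx (TangentSpace (𝓡 n) x)) :
    w - Complex.I • Cx.map (K.I s x) w ∈ Cx.eig (K.I s x) Complex.I := by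
  rw [Cx.mem_eig, map_sub, map_smul, K.map_I_sq]
  linear_combination (norm := module) Complex.I_mul_I • Cx.map (K.I s x) w

/-- The lift to the `-i`-eigenspace of `J₊` of a `(1,0)`-form `g w`. -/
def lift (s : Sgn) (x : M) (w : Cx (TangentSpace (𝓡 n) x)) : Cx (E x) :=
  Cx.map (K.split s x) (K.liftSame s x w) + Cx.map (K.split s.opp x) (K.liftOpp s x w)

theorem lift_mem_eig_Jp (s : Sgn) (x : M) (w : Cx (TangentSpace (𝓡 n) x)) :
    K.lift s x w ∈ Cx.eig (K.Jp x) (-Complex.I) :=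
  Submodule.add_mem _
    (K.split_mem_eig_Jp (Submodule.smul_mem _ _ (K.add_smul_I_mem_eig s x _)))
    (K.split_mem_eig_Jp (Submodule.smul_mem _ _ (K.add_smul_I_mem_eig s.opp x _)))

theorem mapDual_ι (s : Sgn) (x : M) (ξ : TangentSpace (𝓡 n) x →ₗ[ℝ] ℂ) :
    Cx.mapDual (𝓔.ι x) ξ = (s.val : ℂ) • (Cx.map (K.split s x) (Cx.mapDual (K.ginv x) ξ)
      - Cx.map (K.split s.opp x) (Cx.mapDual (K.ginv x) ξ)) := by
  ext1 <;> simp [K.ι_eq_smul s, -Complex.coe_smul]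

theorem lift_add_ι_mem_eig_Jm {s : Sgn} {x : M} {ξ : TangentSpace (𝓡 n) x →ₗ[ℝ] ℂ}
    (hξ : ξ ∈ Cx.form10 (K.I s x)) :
    K.lift s x (Cx.mapDual (K.ginv x) ξ) + Cx.mapDual (𝓔.ι x) ξ
      ∈ Cx.eig (K.Jm x) (-(s.val * Complex.I)) := by
  set w := Cx.mapDual (K.ginv x) ξ with hw
  have hwe := K.mapDual_ginv_mem_eig hξ
  -- In `C_{-s}` the lift cancels the (0,1)-part of `-s w` and leaves the (1,0)-part, where `J₋` has
  -- the required eigenvalue. In `C_s` both summands are already of type (0,1).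
  have h1 : K.lift s x w + Cx.mapDual (𝓔.ι x) ξ
      = Cx.map (K.split s x) (K.liftSame s x w + (s.val : ℂ) • w)
        + Cx.map (K.split s.opp x)
          ((-(s.val / 2) : ℂ) • (w - Complex.I • Cx.map (K.I s.opp x) w)) := by
    rw [K.mapDual_ι s, lift, ← hw]
    simp only [liftOpp, map_add, map_sub, map_smul]
    module
  rw [h1]
  refine Submodule.add_mem _ ?_ ?_
  · have := K.split_mem_eig_Jm (s := s) (Submodule.add_mem _
      (Submodule.smul_mem _ (-1 / 2 : ℂ) (K.add_smul_I_mem_eig s x (K.liftOpp s x w)))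
      (Submodule.smul_mem _ (s.val : ℂ) hwe))
    rwa [mul_neg] at this
  · have := K.split_mem_eig_Jm (s := s.opp) (Submodule.smul_mem _ (-(s.val / 2) : ℂ)
      (K.sub_smul_I_mem_eig s.opp x w))
    rwa [Sgn.val_opp, Complex.ofReal_neg, neg_mul] at this

/-- `liftSame` is minus the (0,1)-part of `liftOpp` for `I_s`, so the anchor is the (1,0)-part of
`liftOpp`. With `I_s w = -i w` this is `(s/4)(I_s I_{-s} w + i I_{-s} w)`, and the two halves of
`bivec` contribute equally to it. -/
theorem anchor_lift {s : Sgn} {x : M} {w : Cx (TangentSpace (𝓡 n) x)}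
    (hw : w ∈ Cx.eig (K.I s x) (-Complex.I)) :
    Cx.map (𝓔.anchor x) (K.lift s x w) = K.bivec s x w := by
  rw [Cx.mem_eig] at hw
  rw [lift, map_add, K.map_anchor_split, K.map_anchor_split, K.bivec_apply]
  simp only [liftSame, liftOpp, map_add, map_smul, hw]
  linear_combination (norm := module) Complex.I_mul_I • ((s.val / 4 : ℂ) • w
    - (s.val / 8 : ℂ) • Cx.map (K.I s x) (Cx.map (K.I s.opp x) w))

end GeneralizedKahler
end Bivector

/-! ### The Baer sum as a graph, and the Poisson property. -/

section Poisson

variable {n : ℕ} {M : Type*} [TopologicalSpace M] [ChartedSpace (EuclideanSpace ℝ (Fin n)) M]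
  [IsManifold (𝓡 n) ∞ M]
  {F : Type*} [NormedAddCommGroup F] [NormedSpace ℝ F]
  {E : M → Type*} [TopologicalSpace (TotalSpace F E)] [∀ x, TopologicalSpace (E x)]
  [∀ x, AddCommGroup (E x)] [∀ x, Module ℝ (E x)] [FiberBundle F E] [VectorBundle ℝ F E]
  {𝓔 : ExactCourantAlgebroid n F E}

theorem smoothCForm_zero :
    SmoothCForm (n := n) (fun x : M => (0 : TangentSpace (𝓡 n) x →ₗ[ℝ] ℂ)) :=
  fun _ _ => contMDiff_const

namespace GeneralizedKahler

variable (K : GeneralizedKahler 𝓔)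

/-! ### The Baer sum -/

theorem exists_ι_of_anchor_eq_zero (𝓔 : ExactCourantAlgebroid n F E) {x : M} {e : Cx (E x)}
    (he : Cx.map (𝓔.anchor x) e = 0) :
    ∃ ξ : TangentSpace (𝓡 n) x →ₗ[ℝ] ℂ, Cx.mapDual (𝓔.ι x) ξ = e := by
  obtain ⟨a, ha⟩ := (𝓔.exact x e.re).1 (congrArg Cx.re he)
  obtain ⟨b, hb⟩ := (𝓔.exact x e.im).1 (congrArg Cx.im he)
  refine ⟨Cx.ofRealForm a + Complex.I • Cx.ofRealForm b, Cx.ext ?_ ?_⟩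
  · rw [← ha, Cx.mapDual_re]
    congr 1
    ext v
    simp [Cx.ofRealForm]
  · rw [← hb, Cx.mapDual_im]
    congr 1
    ext v
    simp [Cx.ofRealForm]

/-- The vectors `v + i I_s v` are of type (0,1), so their lifts lie in `ellBar`. Pairing with such a
lift is evaluation of `ξ`. -/
theorem mem_form10_of_perp {s : Sgn} {x : M} {ξ : TangentSpace (𝓡 n) x →ₗ[ℝ] ℂ}
    (h : Cx.mapDual (𝓔.ι x) ξ ∈ perp (𝓔.pairingC x) (K.ellBar s x)) :
    ξ ∈ Cx.form10 (K.I s x) := by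
  intro v
  have h1 := h _ (K.split_mem_ellBar (K.add_smul_I_mem_eig s x ⟨v, 0⟩))
  change 𝓔.pairingC x _ _ = 0 at h1
  rw [𝓔.pairingC_symm, 𝓔.pairingC_ι, K.map_anchor_split, map_add, map_smul] at h1
  simp only [Cx.eval, LinearMap.coe_mk, AddHom.coe_mk, Cx.map_re, Cx.map_im, map_zero, mul_zero,
    add_zero, smul_eq_mul] at h1
  linear_combination (-Complex.I) * h1 + ξ (K.I s x v) * Complex.I_mul_I

theorem redAnchor_mkQ (s : Sgn) (x : M) (v : perp (𝓔.pairingC x) (K.ellBar s x)) :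
    K.redAnchor s x (Submodule.mkQ _ v)
      = Cx.proj10 (K.I s x) (Cx.map (𝓔.anchor x) v.1) := rfl

theorem proj10_of_mem {s : Sgn} {x : M} {v : Cx (TangentSpace (𝓡 n) x)}
    (hv : v ∈ Cx.eig (K.I s x) Complex.I) : Cx.proj10 (K.I s x) v = v := by
  simp only [Cx.proj10, LinearMap.smul_apply, LinearMap.sub_apply, LinearMap.id_apply,
    Cx.mem_eig.1 hv, smul_smul, Complex.I_mul_I]
  module

theorem mem_eig_of_proj10 {s : Sgn} {x : M} {v : Cx (TangentSpace (𝓡 n) x)}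
    (hv : Cx.proj10 (K.I s x) v = 0) : v ∈ Cx.eig (K.I s x) (-Complex.I) := by
  simp only [Cx.proj10, LinearMap.smul_apply, LinearMap.sub_apply, LinearMap.id_apply] at hv
  rw [Cx.mem_eig]
  linear_combination (norm := module) (2 * Complex.I) • hv
    + Complex.I_mul_I • Cx.map (K.I s x) v

theorem redAnchor_redIncl (s : Sgn) (x : M) (ξ : Cx.form10 (K.I s x)) :
    K.redAnchor s x (K.redIncl s x ξ) = 0 := by
  change Cx.proj10 (K.I s x) (Cx.map (𝓔.anchor x) (Cx.mapDual (𝓔.ι x) ξ.1)) = 0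
  rw [𝓔.map_anchor_ι, map_zero]

/-- Exactness of the reduced extension. A representative has anchor of type (0,1), and subtracting
the lift of that anchor to `ellBar` leaves an element of the image of `ι`, still in the orthogonal
complement. -/
theorem exists_redIncl_of_redAnchor {s : Sgn} {x : M} {q : Red (𝓔.pairingC x) (K.ellBar s x)}
    (hq : K.redAnchor s x q = 0) : ∃ ξ, K.redIncl s x ξ = q := by
  obtain ⟨v, rfl⟩ := Submodule.mkQ_surjective _ q
  rw [K.redAnchor_mkQ] at hq
  have h1 := K.split_mem_ellBar (K.mem_eig_of_proj10 hq)
  set d := Cx.map (K.split s x) (Cx.map (𝓔.anchor x) v.1) with hd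
  obtain ⟨ξ, hξ⟩ := exists_ι_of_anchor_eq_zero 𝓔 (e := v.1 - d)
    (by rw [map_sub, hd, K.map_anchor_split, sub_self])
  have hD : K.ellBar s x ≤ perp (𝓔.pairingC x) (K.ellBar s x) :=
    inf_le_left.trans (K.eig_Jp_le_perp s x)
  have hξ' : ξ ∈ Cx.form10 (K.I s x) := K.mem_form10_of_perp (by
    rw [hξ]; exact Submodule.sub_mem _ v.2 (hD h1))
  refine ⟨⟨ξ, hξ'⟩, ?_⟩
  rw [← sub_eq_zero]
  change Submodule.mkQ _ (⟨Cx.mapDual (𝓔.ι x) ξ, K.mapDual_mem_perp s x ⟨ξ, hξ'⟩⟩ :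
    perp (𝓔.pairingC x) (K.ellBar s x)) - Submodule.mkQ _ v = 0
  rw [← map_sub, Submodule.mkQ_apply, Submodule.Quotient.mk_eq_zero]
  change Cx.mapDual (𝓔.ι x) ξ - v.1 ∈ K.ellBar s x
  rw [hξ, sub_sub_cancel_left]
  exact Submodule.neg_mem _ h1

/-- Every `(1,0)`-form `ξ` is a difference of elements of `B_±` and `A_±` over `σ_± ξ`. -/
theorem exists_mem_A_add_mem_B (s : Sgn) (x : M) (ξ : Cx.form10 (K.I s x)) :
    ∃ α ∈ K.A s x, α + K.redIncl s x ξ ∈ K.B s x ∧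
      K.redAnchor s x α = K.poisson s x ξ.1 := by
  set w := Cx.mapDual (K.ginv x) ξ.1 with hw
  refine ⟨Submodule.mkQ _ ⟨K.lift s x w, K.eig_Jp_le_perp s x (K.lift_mem_eig_Jp s x w)⟩,
    (K.mkQ_mem_A _).2 (K.lift_mem_eig_Jp s x w), ?_, ?_⟩
  · exact (K.mkQ_mem_B (⟨K.lift s x w, K.eig_Jp_le_perp s x (K.lift_mem_eig_Jp s x w)⟩
      + ⟨Cx.mapDual (𝓔.ι x) ξ.1, K.mapDual_mem_perp s x ξ⟩)).2 (K.lift_add_ι_mem_eig_Jm ξ.2)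
  · rw [K.redAnchor_mkQ, K.anchor_lift (K.mapDual_ginv_mem_eig ξ.2),
      K.proj10_of_mem (K.bivec_mem_eig s x w)]
    rfl

/-- Two such `α` for the same `ξ` differ by an element of `A ∩ B = 0`, so the explicit lift
determines the anchor. -/
theorem redAnchor_eq_poisson {s : Sgn} {x : M} {ξ : Cx.form10 (K.I s x)}
    {α : Red (𝓔.pairingC x) (K.ellBar s x)} (hA : α ∈ K.A s x)
    (hB : α + K.redIncl s x ξ ∈ K.B s x) : K.redAnchor s x α = K.poisson s x ξ.1 := by
  obtain ⟨β, hβA, hβB, hβ⟩ := K.exists_mem_A_add_mem_B s x ξ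
  have h1 : α - β ∈ K.B s x := by
    have := Submodule.sub_mem _ hB hβB
    rwa [add_sub_add_right_eq_sub] at this
  have h2 := Submodule.disjoint_def.1 (K.isCompl_A_B s x).disjoint _
    (Submodule.sub_mem _ hA hβA) h1
  rw [sub_eq_zero.1 h2, hβ]

theorem baerAB_eq_graph (s : Sgn) (x : M) :
    (K.baerAB s x : Set (BaerSum (K.redAnchor s x) (K.redAnchor s x) (-K.redIncl s x)
      (K.redIncl s x))) =
      graphInBaer (K.redAnchor s x) (K.redIncl s x) (fun ξ => K.poisson s x ξ.1) := by
  ext q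
  constructor
  · rintro ⟨y, hy, rfl⟩
    obtain ⟨⟨α, β⟩, ⟨⟨hα, hβ⟩, hp⟩, k, hk, hy'⟩ := Submodule.mem_sup.1 hy
    have hp' : K.redAnchor s x α = K.redAnchor s x β := hp
    -- Equal anchors make `β - α` a form `ι ξ`, which is the cotangent coordinate in the Baer sum.
    obtain ⟨ξ, hξ⟩ := K.exists_redIncl_of_redAnchor (q := β - α)
      (by rw [map_sub, hp', sub_self])
    obtain rfl : α + K.redIncl s x ξ = β := by rw [hξ, add_sub_cancel]
    refine ⟨ξ, α, hp, K.redAnchor_eq_poisson hα hβ, ?_⟩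
    rw [← sub_eq_zero, ← map_sub, Submodule.mkQ_apply, Submodule.Quotient.mk_eq_zero]
    change y.1 - (α, α + K.redIncl s x ξ) ∈ baerK _ _
    have h3 : (α, α + K.redIncl s x ξ) + k = y.1 := hy'
    rw [← h3, add_sub_cancel_left]
    exact hk
  · rintro ⟨ξ, e, h, he, rfl⟩
    obtain ⟨α, hA, hB, hα⟩ := K.exists_mem_A_add_mem_B s x ξ
    obtain ⟨η, hη⟩ := K.exists_redIncl_of_redAnchor (q := e - α)
      (by rw [map_sub, hα, he, sub_self])
    -- The representatives `(e, e + ι ξ)` and `(α, α + ι ξ)` differ by the diagonal element with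
    -- entries `e - α = ι η`. It lies in `baerK (-j) j` because the two minus signs there cancel.
    refine ⟨_, Submodule.mem_sup.2 ⟨(α, α + K.redIncl s x ξ), ⟨⟨hA, hB⟩, ?_⟩,
      (K.redIncl s x η, K.redIncl s x η), ⟨η, ?_⟩, ?_⟩, rfl⟩
    · change K.redAnchor s x α = K.redAnchor s x (α + K.redIncl s x ξ)
      rw [map_add, K.redAnchor_redIncl, add_zero]
    · simp
    · rw [hη]
      change (α + (e - α), α + K.redIncl s x ξ + (e - α)) = (e, e + K.redIncl s x ξ)
      ext1 <;> abel_nf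

/-! ### The real part -/

theorem g_rePart_poisson (s : Sgn) (x : M) (ξ : TangentSpace (𝓡 n) x →ₗ[ℝ] ℝ) :
    K.g x (rePart (K.poisson s x) ξ) = (1 / 8 : ℝ) •
      (K.Istar .plus x (K.Istar .minus x ξ) - K.Istar .minus x (K.Istar .plus x ξ)) := by
  have h1 : rePart (K.poisson s x) ξ = (1 / 8 : ℝ) •
      (K.I .plus x (K.I .minus x (K.ginv x ξ)) - K.I .minus x (K.I .plus x (K.ginv x ξ))) := by
    have hre : Complex.reLm ∘ₗ Cx.ofRealForm ξ = ξ := by ext v; simp [Cx.ofRealForm]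
    have him : Complex.imLm ∘ₗ Cx.ofRealForm ξ = 0 := by ext v; simp [Cx.ofRealForm]
    have hs : (s.val / 8 : ℂ) = ((s.val / 8 : ℝ) : ℂ) := by push_cast; ring
    simp only [rePart, poisson, LinearMap.comp_apply, K.bivec_apply, hs, Cx.smul_re, Cx.sub_re,
      Cx.add_re, Cx.smul_im, Cx.add_im, Cx.sub_im, Cx.map_re, Cx.map_im, Cx.mapDual_re,
      Cx.mapDual_im, hre, him, map_zero, Complex.ofReal_re, Complex.ofReal_im, Complex.I_re,
      Complex.I_im]
    -- On a real covector the `i`-term of `bivec` is purely imaginary. For the minus sign, `s = -1`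
    -- compensates the reversed order in the commutator.
    cases s <;> simp only [Sgn.val, Sgn.opp] <;> module
  ext v
  rw [h1, map_smul, map_sub]
  simp only [LinearMap.smul_apply, LinearMap.sub_apply, K.g_I_left, K.g_ginv, neg_neg]
  rfl

/-! ### The Poisson structure -/

variable [T2Space M] [ContMDiffVectorBundle ∞ F E (𝓡 n)]

theorem smoothCVF_mapDual_ginv {ξ : ∀ x : M, TangentSpace (𝓡 n) x →ₗ[ℝ] ℂ}
    (hξ : SmoothCForm ξ) : SmoothCVF (fun x => Cx.mapDual (K.ginv x) (ξ x)) :=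
  ⟨K.smoothVF_ginv hξ.re, K.smoothVF_ginv hξ.im⟩

theorem smoothCVF_poisson (s : Sgn) {ξ : ∀ x : M, TangentSpace (𝓡 n) x →ₗ[ℝ] ℂ}
    (hξ : SmoothCForm ξ) : SmoothCVF (fun x => K.poisson s x (ξ x)) := by
  have hw := K.smoothCVF_mapDual_ginv hξ
  have h1 := K.smoothCVF_I s hw
  have h2 := K.smoothCVF_I s.opp hw
  have h3 := K.smoothCVF_I s.opp h1
  exact (((K.smoothCVF_I s h2).sub h3).add
    ((h2.add (K.smoothCVF_I s h3)).const_smul Complex.I)).const_smul (s.val / 8 : ℂ)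

theorem smoothCForm_formProj (s : Sgn) {ξ : ∀ x : M, TangentSpace (𝓡 n) x →ₗ[ℝ] ℂ}
    (hξ : SmoothCForm ξ) : SmoothCForm (fun x => Cx.formProj (K.I s x) (ξ x)) := by
  intro X hX
  have h1 := hξ X hX
  have h2 := hξ _ (K.smoothVF_I s hX)
  have hc : ∀ (c : ℂ) {f : M → ℂ}, ContMDiff (𝓡 n) 𝓘(ℝ, ℂ) ∞ f →
      ContMDiff (𝓡 n) 𝓘(ℝ, ℂ) ∞ (fun x => c * f x) := fun c f hf =>
    (ContinuousLinearMap.contMDiff (ContinuousLinearMap.mul ℝ ℂ c)).comp hf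
  exact hc (1 / 2) (h1.sub (hc Complex.I h2))

/-- Every smooth `(1,0)`-form lifts to a smooth section of the `-i`-eigenbundle of `J₊`. -/
theorem exists_lift {s : Sgn} {ξ : ∀ x : M, TangentSpace (𝓡 n) x →ₗ[ℝ] ℂ}
    (hξ : SmoothCForm ξ) (h10 : ∀ x, ξ x ∈ Cx.form10 (K.I s x)) :
    ∃ a : Cx (Cₛ^∞⟮𝓡 n; F, E⟯), (∀ x, csec a x ∈ Cx.eig (K.Jp x) (-Complex.I)) ∧
      (∀ x, csec (a + 𝓔.ιSec hξ) x ∈ Cx.eig (K.Jm x) (-(s.val * Complex.I))) ∧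
      ∀ x, Cx.map (𝓔.anchor x) (csec a x) = K.poisson s x (ξ x) := by
  have hw := K.smoothCVF_mapDual_ginv hξ
  have ho : SmoothCVF (fun x => K.liftOpp s x (Cx.mapDual (K.ginv x) (ξ x))) :=
    (hw.add ((K.smoothCVF_I s.opp hw).const_smul Complex.I)).const_smul _
  have hs : SmoothCVF (fun x => K.liftSame s x (Cx.mapDual (K.ginv x) (ξ x))) :=
    (ho.add ((K.smoothCVF_I s ho).const_smul Complex.I)).const_smul _
  exact ⟨K.splitCSec s hs + K.splitCSec s.opp ho, fun x => K.lift_mem_eig_Jp s x _,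
    fun x => K.lift_add_ι_mem_eig_Jm (h10 x),
    fun x => K.anchor_lift (K.mapDual_ginv_mem_eig (h10 x))⟩

/-- The integrability identity for three sections `a` of the `-i`-eigenbundle of `J₊` such that
the sections `a + ι ξ` lie in an eigenbundle of `J₋`. -/
theorem lieForm_identity {s : Sgn} {ξ₁ ξ₂ ξ₃ : ∀ x : M, TangentSpace (𝓡 n) x →ₗ[ℝ] ℂ}
    (h₁ : SmoothCForm ξ₁) (h₂ : SmoothCForm ξ₂) (h₃ : SmoothCForm ξ₃)
    {a₁ a₂ a₃ : Cx (Cₛ^∞⟮𝓡 n; F, E⟯)} {X₁ X₂ X₃ : ∀ x : M, Cx (TangentSpace (𝓡 n) x)}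
    (hX₁ : ∀ x, Cx.map (𝓔.anchor x) (csec a₁ x) = X₁ x)
    (hX₂ : ∀ x, Cx.map (𝓔.anchor x) (csec a₂ x) = X₂ x)
    (hX₃ : ∀ x, Cx.map (𝓔.anchor x) (csec a₃ x) = X₃ x)
    (ha₁ : ∀ x, csec a₁ x ∈ Cx.eig (K.Jp x) (-Complex.I))
    (ha₂ : ∀ x, csec a₂ x ∈ Cx.eig (K.Jp x) (-Complex.I))
    (ha₃ : ∀ x, csec a₃ x ∈ Cx.eig (K.Jp x) (-Complex.I))
    (hb₁ : ∀ x, csec (a₁ + 𝓔.ιSec h₁) x ∈ Cx.eig (K.Jm x) (-(s.val * Complex.I)))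
    (hb₂ : ∀ x, csec (a₂ + 𝓔.ιSec h₂) x ∈ Cx.eig (K.Jm x) (-(s.val * Complex.I)))
    (hb₃ : ∀ x, csec (a₃ + 𝓔.ιSec h₃) x ∈ Cx.eig (K.Jm x) (-(s.val * Complex.I))) (x : M) :
    lieForm X₁ ξ₂ X₃ x - lieForm X₂ ξ₁ X₃ x + dirDeriv X₃ (fun y => Cx.eval (ξ₁ y) (X₂ y)) x
      + Cx.eval (ξ₃ x) (cLie X₁ X₂ x) = 0 := by
  have h := 𝓔.pairingC_bracketC_add_ι h₁ h₂ h₃ a₁ a₂ a₃ hX₁ hX₂ hX₃ x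
  have hi : -Complex.I = Complex.I ∨ -Complex.I = -Complex.I := Or.inr rfl
  have hc := Sgn_val_mul_I s
  -- Each eigenbundle is involutive and isotropic, so both triple pairings vanish and only the terms
  -- in the forms survive.
  rw [K.isGC_m.isotropic hc (K.isGC_m.bracketC_mem_eig hc hb₁ hb₂ x) (hb₃ x),
    K.isGC_p.isotropic hi (K.isGC_p.bracketC_mem_eig hi ha₁ ha₂ x) (ha₃ x)] at h
  linear_combination -h

/-- `lieForm_identity` is applied to the lift of `V` to `ellBar`, which lies in both eigenbundles
and so carries the zero form, and to the lifts of `ξ` and `η`. Expanding the Lie derivative of `η`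
turns the result into the claim. -/
theorem poisson_holomorphic (s : Sgn) {V : ∀ x : M, Cx (TangentSpace (𝓡 n) x)}
    (hV : SmoothCVF V) (hVe : ∀ x, V x ∈ Cx.eig (K.I s x) (-Complex.I))
    {ξ η : ∀ x : M, TangentSpace (𝓡 n) x →ₗ[ℝ] ℂ} (hξ : SmoothCForm ξ) (hη : SmoothCForm η)
    (hξ' : ∀ x, ξ x ∈ Cx.form10 (K.I s x)) (hη' : ∀ x, η x ∈ Cx.form10 (K.I s x)) (x : M) :
    dirDeriv V (fun y => Cx.eval (η y) (K.poisson s y (ξ y))) x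
      - (-lieForm V ξ (fun y => K.poisson s y (η y)) x)
      - lieForm V η (fun y => K.poisson s y (ξ y)) x = 0 := by
  obtain ⟨a, ha, hab, hX⟩ := K.exists_lift hξ hξ'
  obtain ⟨b, hb, hbb, hY⟩ := K.exists_lift hη hη'
  have hd := fun y => K.split_mem_ellBar (hVe y)
  have h0 : ∀ y, csec (K.splitCSec s hV + 𝓔.ιSec (smoothCForm_zero (n := n) (M := M))) y
      = Cx.map (K.split s y) (V y) := by
    intro y
    rw [csec_add, 𝓔.csec_ιSec, map_zero, add_zero, K.csec_splitCSec]
  have h := K.lieForm_identity (s := s) smoothCForm_zero hξ hη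
    (a₁ := K.splitCSec s hV) (X₁ := V) (fun y => K.map_anchor_split s y (V y)) hX hY
    (fun y => (hd y).1) ha hb (fun y => by rw [h0]; exact (hd y).2) hab hbb x
  have hz : ∀ (y : M) (v : Cx (TangentSpace (𝓡 n) y)), Cx.eval 0 v = 0 := by
    intro y v; simp [Cx.eval]
  simp only [lieForm, hz, dirDeriv_zero] at h ⊢
  linear_combination h

theorem poisson_jacobi (s : Sgn) {f g h : M → ℂ} (hf : ContMDiff (𝓡 n) 𝓘(ℝ, ℂ) ∞ f)
    (hg : ContMDiff (𝓡 n) 𝓘(ℝ, ℂ) ∞ g) (hh : ContMDiff (𝓡 n) 𝓘(ℝ, ℂ) ∞ h) (x : M) :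
    poissonBracket (K.poisson s) f (poissonBracket (K.poisson s) g h) x
      + poissonBracket (K.poisson s) g (poissonBracket (K.poisson s) h f) x
      + poissonBracket (K.poisson s) h (poissonBracket (K.poisson s) f g) x = 0 := by
  let X : (M → ℂ) → ∀ x : M, Cx (TangentSpace (𝓡 n) x) := fun u y => K.poisson s y (cdiff u y)
  have hXe : ∀ u y, X u y ∈ Cx.eig (K.I s y) Complex.I := fun u y => K.bivec_mem_eig s y _
  have hXs : ∀ {u : M → ℂ}, ContMDiff (𝓡 n) 𝓘(ℝ, ℂ) ∞ u → SmoothCVF (X u) :=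
    fun hu => K.smoothCVF_poisson s (smoothCForm_cdiff hu)
  -- Only (1,0)-forms lift, so differentials are replaced by their (1,0)-parts. This changes neither
  -- the Hamiltonian field nor the values on (1,0)-vectors.
  have hξ : ∀ {u : M → ℂ}, ContMDiff (𝓡 n) 𝓘(ℝ, ℂ) ∞ u →
      SmoothCForm (fun y => Cx.formProj (K.I s y) (cdiff u y)) :=
    fun hu => K.smoothCForm_formProj s (smoothCForm_cdiff hu)
  have hlift := fun {u : M → ℂ} (hu : ContMDiff (𝓡 n) 𝓘(ℝ, ℂ) ∞ u) =>
    K.exists_lift (s := s) (hξ hu) (fun y => Cx.formProj_mem (K.I_sq s y) _)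
  simp only [K.poisson_formProj] at hlift
  obtain ⟨a, ha, hab, haX⟩ := hlift hf
  obtain ⟨b, hb, hbb, hbX⟩ := hlift hg
  obtain ⟨c, hc, hcb, hcX⟩ := hlift hh
  have key := K.lieForm_identity (hξ hf) (hξ hg) (hξ hh) (X₁ := X f) (X₂ := X g) (X₃ := X h)
    haX hbX hcX ha hb hc hab hbb hcb x
  -- By integrability, brackets of Hamiltonian fields are again of type (1,0), so the projections
  -- can be dropped on them too and the bracket acts as a commutator.
  have hL : ∀ {u v : M → ℂ}, ContMDiff (𝓡 n) 𝓘(ℝ, ℂ) ∞ u → ContMDiff (𝓡 n) 𝓘(ℝ, ℂ) ∞ v →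
      cLie (X u) (X v) x ∈ Cx.eig (K.I s x) Complex.I := fun hu hv =>
    (K.isComplexStructure_I s).involutive _ _ (hXs hu) (hXs hv) (hXe _) (hXe _) x
  have heval : ∀ (u v : M → ℂ) (y : M),
      Cx.eval (Cx.formProj (K.I s y) (cdiff u y)) (X v y) = dirDeriv (X v) u y :=
    fun u v y => Cx.eval_formProj (hXe v y)
  simp only [lieForm, heval, Cx.eval_formProj (hL hf hh), Cx.eval_formProj (hL hg hh),
    Cx.eval_formProj (hL hf hg), dirDeriv_cLie (hXs hf) (hXs hh) hg,
    dirDeriv_cLie (hXs hg) (hXs hh) hf, dirDeriv_cLie (hXs hf) (hXs hg) hh] at key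
  -- After cancellation `key` reads `X_f X_g h + X_h X_f g - X_g X_f h = 0`. Skewness rewrites the
  -- last term to complete the cyclic sum.
  have hskew : dirDeriv (X f) h = fun y => -dirDeriv (X h) f y := by
    funext y
    exact K.poisson_skew s y _ _
  have h1 : dirDeriv (X g) (dirDeriv (X f) h) x = -dirDeriv (X g) (dirDeriv (X h) f) x := by
    rw [hskew]
    exact dirDeriv_neg _ _ _
  change dirDeriv (X f) (dirDeriv (X g) h) x + dirDeriv (X g) (dirDeriv (X h) f) x
    + dirDeriv (X h) (dirDeriv (X f) g) x = 0
  change dirDeriv (X f) (dirDeriv (X h) g) x - (dirDeriv (X f) (dirDeriv (X h) g) x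
      - dirDeriv (X h) (dirDeriv (X f) g) x)
    - (dirDeriv (X g) (dirDeriv (X h) f) x - (dirDeriv (X g) (dirDeriv (X h) f) x
      - dirDeriv (X h) (dirDeriv (X g) f) x))
    + dirDeriv (X h) (dirDeriv (X g) f) x
    + (dirDeriv (X f) (dirDeriv (X g) h) x - dirDeriv (X g) (dirDeriv (X f) h) x) = 0 at key
  linear_combination key + h1

theorem isHolomorphicPoisson_poisson (s : Sgn) : IsHolomorphicPoisson (K.I s) (K.poisson s) where
  skew := K.poisson_skew s
  type x _ := K.bivec_mem_eig s x _
  smooth _ hξ := K.smoothCVF_poisson s hξ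
  holomorphic _ hV hVe _ _ hξ hη hξ' hη' x := K.poisson_holomorphic s hV hVe hξ hη hξ' hη' x
  jacobi _ _ _ hf hg hh x := K.poisson_jacobi s hf hg hh x

end GeneralizedKahler
end Poisson

end GenKahler
end

theorem mainTheorem5 {n : ℕ} {M : Type*} [TopologicalSpace M] [T2Space M]
    [SecondCountableTopology M] [ChartedSpace (EuclideanSpace ℝ (Fin n)) M]
    [IsManifold (𝓡 n) ∞ M]
    {F : Type*} [NormedAddCommGroup F] [NormedSpace ℝ F] [FiniteDimensional ℝ F]
    {E : M → Type*} [TopologicalSpace (TotalSpace F E)] [∀ x, TopologicalSpace (E x)]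
    [∀ x, AddCommGroup (E x)] [∀ x, Module ℝ (E x)] [FiberBundle F E] [VectorBundle ℝ F E]
    [ContMDiffVectorBundle ∞ F E (𝓡 n)]
    (𝓔 : GenKahler.ExactCourantAlgebroid n F E) (K : GenKahler.GeneralizedKahler 𝓔) :
    -- `X_± = (M, I_±)` are complex manifolds, and `A_±`, `B_±` are transverse holomorphic Dirac
    -- structures in the reductions `E_±`
    (∀ s, GenKahler.IsComplexStructure (K.I s)
      ∧ 𝓔.IsHolomorphicDirac (K.ellBar s) (K.A s)
      ∧ 𝓔.IsHolomorphicDirac (K.ellBar s) (K.B s)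
      ∧ ∀ x, IsCompl (K.A s x) (K.B s x)) ∧
    -- the Baer sum of `A_±^⊤` and `B_±` is the graph of a holomorphic Poisson structure `σ_±`
    -- with real part `(1/8) g⁻¹ [I_+^*, I_-^*]`
    ∃ σ : GenKahler.Sgn → ∀ x : M, (TangentSpace (𝓡 n) x →ₗ[ℝ] ℂ) →ₗ[ℂ]
        GenKahler.Cx (TangentSpace (𝓡 n) x),
      ∀ s, GenKahler.IsHolomorphicPoisson (K.I s) (σ s)
        ∧ (∀ x, (K.baerAB s x : Set _) =
            GenKahler.graphInBaer (K.redAnchor s x) (K.redIncl s x) (fun ξ => σ s x ξ.1))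
        ∧ ∀ x, ∀ ξ : TangentSpace (𝓡 n) x →ₗ[ℝ] ℝ,
            K.g x (GenKahler.rePart (σ s x) ξ) = (1 / 8 : ℝ) •
              (K.Istar .plus x (K.Istar .minus x ξ) - K.Istar .minus x (K.Istar .plus x ξ)) :=
  ⟨fun s => ⟨K.isComplexStructure_I s,
    K.isGC_p.isHolomorphicDirac_redSub (Or.inr rfl) (fun _ => inf_le_left),
    K.isGC_m.isHolomorphicDirac_redSub (GenKahler.GeneralizedKahler.Sgn_val_mul_I s)
      (fun _ => inf_le_right),
    K.isCompl_A_B s⟩,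
    K.poisson, fun s => ⟨K.isHolomorphicPoisson_poisson s, K.baerAB_eq_graph s,
      K.g_rePart_poisson s⟩⟩
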